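/- **Theorem (Probabilistic fixed-rank error, Gaussian embeddings).** Let $\mathbb{Q}$ be the real quaternions, $A\in\mathbb{Q}^{m\times n}$ with $m\ge n$, and let $r\le s\le l\le\min\{m,n\}$. Let $A=U\Sigma V^*$ be a quaternion singular value decomposition (QSVD), with singular values $\sigma_1\ge\dots\ge\sigma_n\ge 0$, and let $\Sigma_2=\operatorname{diag}(\sigma_{r+1},\dots,\sigma_n)$ be the trailing block of $\Sigma$, so that $\|\Sigma_2\|_F=(\sum_{i>r}\sigma_i^2)^{1/2}$. Let $\Omega\in\mathbb{Q}^{n\times s}$ and $\Psi\in\mathbb{Q}^{l\times m}$ be independent standard Gaussian quaternion random matrices (all real components of all entries are i.i.d. $N(0,1)$). Form the sketches $Y=A\Omega$ and $W=\Psi A$, let $H=\mathcal F(Y)\in\mathbb{Q}^{m\times s}$ for a measurable rangefinder map $\mathcal F$ such that, almost surely, $H$ has full column rank and $\mathcal R(H)=\mathcal R(Y)$ (equality of right column spaces), and put $X=(\Psi H)^\dagger W$, where $\dagger$ denotes the Moore–Penrose inverse. Let $\lfloor X\rfloor_r$ be (a measurable choice of) the rank-$r$ truncation of $X$ obtained from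 a QSVD of $X$ by keeping its $r$ leading singular values, and let $\hat A=H\lfloor X\rfloor_r$. Let $\kappa(H)=\sigma_{\max}(H)/\sigma_{\min}(H)$, and $$f(p,q)=\frac{4p}{4(q-p)+2}.$$ If $\kappa$ is a constant with $\kappa(H)\le\kappa$ almost surely, then $\|\hat A-A\|_F$ is integrable and $$\mathbb{E}\,\|\hat A-A\|_F\;\le\;\Bigl((1+\kappa)\sqrt{(1+f(s,l))\,(1+f(r,s))}+\kappa\Bigr)\,\|\Sigma_2\|_F .$$ More generally, if only $\mathbb{E}\,\kappa(H)^2<\infty$, the same conclusions hold with $\kappa=(\mathbb{E}\,\kappa(H)^2)^{1/2}$. -/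

import Mathlib

open MeasureTheory ProbabilityTheory
open scoped Quaternion Matrix

/-- The Borel sigma-algebra on the real quaternions. -/
noncomputable instance quaternionMeasurableSpace : MeasurableSpace ℍ[ℝ] := borel ℍ[ℝ]

instance quaternionBorelSpace : BorelSpace ℍ[ℝ] := ⟨rfl⟩

/-- Matrices carry the entrywise (product) sigma-algebra. -/
noncomputable instance matrixMeasurableSpace (m n : ℕ) : MeasurableSpace (Matrix (Fin m) (Fin n) ℍ[ℝ]) :=
  inferInstanceAs (MeasurableSpace (Fin m → Fin n → ℍ[ℝ]))

namespace QMat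

/-- Quaternion matrices of size `m × n`. -/
abbrev QMatrix (m n : ℕ) : Type := Matrix (Fin m) (Fin n) ℍ[ℝ]

/-- The Frobenius norm: the square root of the sum of the squares of all real components. -/
noncomputable def frobNorm {m n : ℕ} (A : QMatrix m n) : ℝ :=
  Real.sqrt (∑ i, ∑ j,
    ((A i j).re ^ 2 + (A i j).imI ^ 2 + (A i j).imJ ^ 2 + (A i j).imK ^ 2))

/-- The range `{A x}` of a quaternion matrix: the right span of its columns. -/
def range {m n : ℕ} (A : QMatrix m n) : Set (Fin m → ℍ[ℝ]) :=
  {v | ∃ x : Fin n → ℍ[ℝ], v = A *ᵥ x}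

/-- Full column rank: the columns are right linearly independent. -/
def FullColumnRank {m n : ℕ} (A : QMatrix m n) : Prop :=
  ∀ x : Fin n → ℍ[ℝ], A *ᵥ x = 0 → x = 0

/-- The four Penrose equations: `X` is the Moore-Penrose inverse of `A`. -/
structure IsMoorePenrose {m n : ℕ} (A : QMatrix m n) (X : QMatrix n m) : Prop where
  mul_mul_self : A * X * A = A
  mul_mul_inv : X * A * X = X
  left_hermitian : (A * X)ᴴ = A * X
  right_hermitian : (X * A)ᴴ = X * A

/-- The Penrose equations determine the Moore-Penrose inverse. -/
theorem IsMoorePenrose.unique {m n : ℕ} {A : QMatrix m n} {X Z : QMatrix n m}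
    (hX : IsMoorePenrose A X) (hZ : IsMoorePenrose A Z) : X = Z := by
  have h1 : A * X = A * Z := by
    calc A * X = (A * X)ᴴ := hX.left_hermitian.symm
      _ = ((A * Z) * (A * X))ᴴ := by rw [← Matrix.mul_assoc, hZ.mul_mul_self]
      _ = (A * X) * (A * Z) := by
          rw [Matrix.conjTranspose_mul, hX.left_hermitian, hZ.left_hermitian]
      _ = A * Z := by rw [← Matrix.mul_assoc, hX.mul_mul_self]
  have h2 : X * A = Z * A := by
    calc X * A = (X * A)ᴴ := hX.right_hermitian.symm
      _ = ((X * A) * (Z * A))ᴴ := by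
          rw [Matrix.mul_assoc, ← Matrix.mul_assoc A, hZ.mul_mul_self]
      _ = (Z * A) * (X * A) := by
          rw [Matrix.conjTranspose_mul, hX.right_hermitian, hZ.right_hermitian]
      _ = Z * A := by rw [Matrix.mul_assoc, ← Matrix.mul_assoc A, hX.mul_mul_self]
  calc X = X * A * X := hX.mul_mul_inv.symm
    _ = Z * A * X := by rw [h2]
    _ = Z * (A * X) := Matrix.mul_assoc _ _ _
    _ = Z * (A * Z) := by rw [h1]
    _ = Z * A * Z := (Matrix.mul_assoc _ _ _).symm
    _ = Z := hZ.mul_mul_inv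

open Classical in
/-- The Moore-Penrose inverse (the unique solution of the four Penrose equations, which
exists for every quaternion matrix). -/
noncomputable def pinv {m n : ℕ} (A : QMatrix m n) : QMatrix n m :=
  if h : ∃ X, IsMoorePenrose A X then h.choose else 0

/-- The rectangular diagonal `m × n` matrix with real diagonal entries `σ 0, σ 1, …`. -/
noncomputable def rectDiag (m n : ℕ) (σ : ℕ → ℝ) : QMatrix m n :=
  Matrix.of fun i j => if (i : ℕ) = (j : ℕ) then ((σ i : ℝ) : ℍ[ℝ]) else 0

/-- A quaternion singular value decomposition `A = U Σ V*`, with `U`, `V` unitary and `Σ` real,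
diagonal, nonnegative, with non-increasing diagonal `σ 0 ≥ σ 1 ≥ …` (indexed from zero, and
extended by zero beyond the diagonal). -/
structure IsQSVD {m n : ℕ} (A : QMatrix m n) (U : QMatrix m m) (σ : ℕ → ℝ) (V : QMatrix n n) :
    Prop where
  left_unitary : Uᴴ * U = 1 ∧ U * Uᴴ = 1
  right_unitary : Vᴴ * V = 1 ∧ V * Vᴴ = 1
  antitone : Antitone σ
  nonneg : ∀ i, 0 ≤ σ i
  eq_zero : ∀ i, min m n ≤ i → σ i = 0
  eq_mul : A = U * rectDiag m n σ * Vᴴ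

/-- `T = ⌊X⌋_r`: `T` arises from a QSVD of `X` by keeping the `r` leading singular values and
setting the others to zero. -/
def IsTruncatedQSVD {m n : ℕ} (r : ℕ) (X T : QMatrix m n) : Prop :=
  ∃ U σ V, IsQSVD X U σ V ∧ T = U * rectDiag m n (fun i => if i < r then σ i else 0) * Vᴴ

/-- `t` is a singular value of `A`: `t ≥ 0` and `t ^ 2` is an eigenvalue of `A* A`. (Used for
matrices with at least as many rows as columns.) -/
def IsSingularValue {m n : ℕ} (A : QMatrix m n) (t : ℝ) : Prop :=
  0 ≤ t ∧ ∃ v : Fin n → ℍ[ℝ], v ≠ 0 ∧ (Aᴴ * A) *ᵥ v = (t ^ 2) • v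

/-- Consistency of the two notions: if `n ≤ m`, then the singular values of `A` are exactly the
diagonal entries of `Σ` in any QSVD of `A`. -/
theorem IsQSVD.isSingularValue_iff {m n : ℕ} (hnm : n ≤ m) {A : QMatrix m n} {U : QMatrix m m} {σ : ℕ → ℝ} {V : QMatrix n n}
    (h : IsQSVD A U σ V) (t : ℝ) :
    IsSingularValue A t ↔ ∃ i < n, σ i = t := by
  have hS : (rectDiag m n σ)ᴴ * rectDiag m n σ =
      Matrix.diagonal (fun j : Fin n => (((σ j)^2 : ℝ) : ℍ[ℝ])) := by
    ext1 i j
    simp only [Matrix.mul_apply, rectDiag, Matrix.conjTranspose_apply, Matrix.of_apply, Matrix.diagonal_apply]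
    rw [Finset.sum_eq_single (⟨i, by omega⟩ : Fin m)]
    · by_cases hij : i = j
      · subst hij; simp [pow_two]
      · have : (i:ℕ) ≠ j := fun h => hij (Fin.ext h)
        simp [hij, this]
    · intro b _ hb
      have : (b:ℕ) ≠ i := fun h => hb (Fin.ext h)
      simp [this]
    · simp
  have hAA : Aᴴ * A = V * Matrix.diagonal (fun j : Fin n => (((σ j)^2 : ℝ) : ℍ[ℝ])) * Vᴴ := by
    rw [← hS, h.eq_mul]
    simp only [Matrix.conjTranspose_mul, Matrix.conjTranspose_conjTranspose, Matrix.mul_assoc]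
    rw [← Matrix.mul_assoc Uᴴ, h.left_unitary.1, Matrix.one_mul]
  constructor
  · rintro ⟨ht, v, hv, e⟩
    have hw : Vᴴ *ᵥ v ≠ 0 := by
      intro h0; apply hv
      have := congrArg (fun w => V *ᵥ w) h0
      simpa [Matrix.mulVec_mulVec, h.right_unitary.2] using this
    obtain ⟨i, hi⟩ := Function.ne_iff.1 hw
    refine ⟨i, i.2, ?_⟩
    have e2 := congrFun (congrArg (fun w => Vᴴ *ᵥ w) e) i
    simp only [hAA, Matrix.mulVec_mulVec, ← Matrix.mul_assoc, h.right_unitary.1, Matrix.one_mul] at e2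
    rw [← Matrix.mulVec_mulVec, Matrix.mulVec_diagonal, Matrix.mulVec_smul, Pi.smul_apply, ← Quaternion.coe_mul_eq_smul] at e2
    have := mul_right_cancel₀ hi e2
    have := Quaternion.coe_injective this
    exact (sq_eq_sq₀ (h.nonneg _) ht).1 this
  · rintro ⟨i, hi, rfl⟩
    refine ⟨h.nonneg _, V *ᵥ Pi.single ⟨i,hi⟩ 1, ?_, ?_⟩
    · intro h0
      have := congrArg (fun w => Vᴴ *ᵥ w) h0
      simp only [Matrix.mulVec_mulVec, h.right_unitary.1, Matrix.one_mulVec, Matrix.mulVec_zero] at this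
      simpa using congrFun this ⟨i, hi⟩
    · rw [hAA, Matrix.mulVec_mulVec, Matrix.mul_assoc, h.right_unitary.1, Matrix.mul_one, ← Matrix.mulVec_mulVec, ← Matrix.mulVec_smul]
      congr 1
      ext1 j
      rw [Matrix.mulVec_diagonal, Pi.smul_apply, ← Quaternion.coe_mul_eq_smul]
      by_cases hj : j = ⟨i,hi⟩
      · subst hj; simp
      · simp [hj]

/-- The condition number: the largest singular value divided by the smallest one. -/
noncomputable def condNum {m n : ℕ} (A : QMatrix m n) : ℝ :=
  sSup {t | IsSingularValue A t} / sInf {t | IsSingularValue A t}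

/-- The four real components of a quaternion. -/
def component (k : Fin 4) (q : ℍ[ℝ]) : ℝ :=
  ![q.re, q.imI, q.imJ, q.imK] k

/-- A standard Gaussian quaternion random matrix: all real components of all entries are
independent standard normal random variables. -/
structure IsStdGaussian {Ω : Type*} [MeasurableSpace Ω] (μ : Measure Ω) {m n : ℕ}
    (G : Ω → QMatrix m n) : Prop where
  measurable : Measurable G
  indep : iIndepFun
    (fun (p : (Fin m × Fin n) × Fin 4) (ω : Ω) => component p.2 (G ω p.1.1 p.1.2)) μ
  law : ∀ p : (Fin m × Fin n) × Fin 4,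
    μ.map (fun ω => component p.2 (G ω p.1.1 p.1.2)) = gaussianReal 0 1

/-- `f (n, m) = 4 n / (4 (m - n) + 2)`, computed in the reals. -/
noncomputable def oversampling (n m : ℕ) : ℝ :=
  4 * (n : ℝ) / (4 * ((m : ℝ) - (n : ℝ)) + 2)

/-- The Frobenius norm of the trailing diagonal block, `(∑_{r ≤ i < n} σ i ^ 2) ^ (1/2)`
(with indices starting at zero). -/
noncomputable def tailNorm (r n : ℕ) (σ : ℕ → ℝ) : ℝ :=
  Real.sqrt (∑ i ∈ Finset.Ico r n, σ i ^ 2)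

/-- The error bound `((1 + κ) √((1 + f(s,l)) (1 + f(r,s))) + κ) * τ`. -/
noncomputable def errorBound (r s l : ℕ) (κ τ : ℝ) : ℝ :=
  ((1 + κ) * Real.sqrt ((1 + oversampling s l) * (1 + oversampling r s)) + κ) * τ

end QMat

/-! The proof splits into a deterministic bound for the truncation and a second moment bound for the
untruncated error `e = ‖H X - A‖`.

Deterministic part (`frobNorm_mul_truncated_sub_le`). Let `W` hold the `r` leading right singular
vectors of `A` and let `Q` be an orthonormal basis of the range of `H`. There is `Z` with `H Z = Q
Qᴴ A W`, so `Z Wᴴ` competes with the truncation `T` of `X` and Eckart-Young gives `‖X - T‖ ≤ ‖X - Z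
Wᴴ‖`. Passing through `H` costs the largest singular value on the left and the inverse of the
smallest on the right, hence a factor `κ(H)`; and `H (X - Z Wᴴ) = Q Qᴴ (H X - A W Wᴴ)`, where the
projection only shrinks norms. Two triangle inequalities yield `‖H T - A‖ ≤ (1 + κ) e + κ ‖Σ₂‖`.

Probabilistic part. Condition on the first test matrix, so that `H` is fixed, and put `B = A - Q Qᴴ
A`. Then `H X - A = Q (Ψ Q)† Ψ B - B` is an orthogonal sum, and rotational invariance makes `Ψ Q`
Gaussian and independent of `Ψ B`. Hence the mean square error is `(1 + 4 E‖(Ψ Q)†‖²) ‖B‖²`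
(`lintegral_sketch_error_le`). A row of `(Ψ Q)†` is no longer than the inverse length of the
component of one Gaussian column orthogonal to the others; that component has `4 (l - s + 1)` real
Gaussian coordinates, and `E (1 / χ²_k) = 1 / (k - 2)` produces `s / (4 (l - s) + 2)` after summing
the rows (`lintegral_leftInv_le`). The same estimate applied to `Aᴴ`, with `W` in the role of `H`
and the adjoint of the first test matrix as sketch, bounds `E‖B‖²` by `(1 + f(r,s)) ‖Σ₂‖²`.

Cauchy-Schwarz for the product of `κ(H)` and `e` combines the two parts. A constant bound `κ` is the
case of a constant coefficient. -/

namespace QMat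

/-! ### The real Frobenius inner product and orthogonal projections. -/

section FrobeniusInner

variable {ι κ α : Type*} [Fintype ι] [Fintype κ] [Fintype α]

/-- The real Frobenius inner product of two quaternion matrices. -/
noncomputable def frobInner (A B : Matrix ι κ ℍ[ℝ]) : ℝ := (Matrix.trace (Aᴴ * B)).re

/-- The square of the Frobenius norm. -/
noncomputable def frobSq (A : Matrix ι κ ℍ[ℝ]) : ℝ := frobInner A A

theorem re_sum {β : Type*} (s : Finset β) (f : β → ℍ[ℝ]) :
    (∑ i ∈ s, f i).re = ∑ i ∈ s, (f i).re :=
  map_sum (QuaternionAlgebra.reₗ (R := ℝ) (-1) 0 (-1)) f s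

theorem re_mul_comm (a b : ℍ[ℝ]) : (a * b).re = (b * a).re := by
  simp only [Quaternion.re_mul]
  ring

/-- Over the quaternions the trace is not cyclic, but its real part is. This is why the inner
product is real valued. -/
theorem re_trace_mul_comm (A : Matrix ι κ ℍ[ℝ]) (B : Matrix κ ι ℍ[ℝ]) :
    (Matrix.trace (A * B)).re = (Matrix.trace (B * A)).re := by
  simp only [Matrix.trace, Matrix.diag_apply, Matrix.mul_apply, re_sum]
  rw [Finset.sum_comm]
  exact Finset.sum_congr rfl fun i _ => Finset.sum_congr rfl fun j _ => re_mul_comm _ _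

theorem frobInner_eq_sum (A B : Matrix ι κ ℍ[ℝ]) :
    frobInner A B = ∑ i, ∑ j, (star (A i j) * B i j).re := by
  simp only [frobInner, Matrix.trace, Matrix.diag_apply, Matrix.mul_apply, re_sum,
    Matrix.conjTranspose_apply]
  exact Finset.sum_comm

theorem frobSq_eq_sum (A : Matrix ι κ ℍ[ℝ]) :
    frobSq A = ∑ i, ∑ j, Quaternion.normSq (A i j) := by
  simp only [frobSq, frobInner_eq_sum, Quaternion.star_mul_self, Quaternion.re_coe]

theorem frobInner_comm (A B : Matrix ι κ ℍ[ℝ]) : frobInner A B = frobInner B A := by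
  simp only [frobInner_eq_sum]
  refine Finset.sum_congr rfl fun i _ => Finset.sum_congr rfl fun j _ => ?_
  simp only [Quaternion.re_mul, Quaternion.re_star, Quaternion.imI_star, Quaternion.imJ_star,
    Quaternion.imK_star]
  ring

theorem frobInner_add_left (A B C : Matrix ι κ ℍ[ℝ]) :
    frobInner (A + B) C = frobInner A C + frobInner B C := by
  simp [frobInner, Matrix.add_mul]

theorem frobInner_add_right (A B C : Matrix ι κ ℍ[ℝ]) :
    frobInner A (B + C) = frobInner A B + frobInner A C := by
  simp [frobInner, Matrix.mul_add]

theorem frobInner_zero_right (A : Matrix ι κ ℍ[ℝ]) : frobInner A 0 = 0 := by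
  simp [frobInner]

theorem frobInner_smul_right (c : ℝ) (A B : Matrix ι κ ℍ[ℝ]) :
    frobInner A (c • B) = c * frobInner A B := by
  simp [frobInner, Matrix.trace_smul]

theorem frobInner_mul_left (A : Matrix ι α ℍ[ℝ]) (B : Matrix α κ ℍ[ℝ]) (C : Matrix ι κ ℍ[ℝ]) :
    frobInner (A * B) C = frobInner B (Aᴴ * C) := by
  simp [frobInner, Matrix.mul_assoc]

theorem frobInner_mul_right (A : Matrix ι α ℍ[ℝ]) (B : Matrix α κ ℍ[ℝ]) (C : Matrix ι κ ℍ[ℝ]) :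
    frobInner (A * B) C = frobInner A (C * Bᴴ) := by
  rw [frobInner, frobInner, Matrix.conjTranspose_mul, Matrix.mul_assoc, re_trace_mul_comm,
    Matrix.mul_assoc]

theorem frobInner_conjTranspose (A B : Matrix ι κ ℍ[ℝ]) :
    frobInner Aᴴ Bᴴ = frobInner A B := by
  rw [frobInner_comm A B, frobInner, frobInner, Matrix.conjTranspose_conjTranspose,
    re_trace_mul_comm]

theorem frobSq_conjTranspose (A : Matrix ι κ ℍ[ℝ]) : frobSq Aᴴ = frobSq A :=
  frobInner_conjTranspose A A

theorem frobSq_nonneg (A : Matrix ι κ ℍ[ℝ]) : 0 ≤ frobSq A := by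
  rw [frobSq_eq_sum]
  exact Finset.sum_nonneg fun i _ => Finset.sum_nonneg fun j _ => Quaternion.normSq_nonneg

theorem frobSq_eq_zero {A : Matrix ι κ ℍ[ℝ]} : frobSq A = 0 ↔ A = 0 := by
  constructor
  · intro h
    rw [frobSq_eq_sum] at h
    ext1 i j
    have hi := (Finset.sum_eq_zero_iff_of_nonneg
      fun i _ => Finset.sum_nonneg fun j _ => Quaternion.normSq_nonneg).1 h i (Finset.mem_univ _)
    exact Quaternion.normSq_eq_zero.1 ((Finset.sum_eq_zero_iff_of_nonneg
      fun j _ => Quaternion.normSq_nonneg).1 hi j (Finset.mem_univ _))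
  · rintro rfl
    simp [frobSq, frobInner]

theorem frobSq_neg (A : Matrix ι κ ℍ[ℝ]) : frobSq (-A) = frobSq A := by
  simp [frobSq, frobInner]

theorem frobSq_sub_comm (A B : Matrix ι κ ℍ[ℝ]) : frobSq (A - B) = frobSq (B - A) := by
  rw [← neg_sub, frobSq_neg]

theorem frobSq_add (A B : Matrix ι κ ℍ[ℝ]) :
    frobSq (A + B) = frobSq A + 2 * frobInner A B + frobSq B := by
  simp only [frobSq, frobInner_add_left, frobInner_add_right, frobInner_comm B A]
  ring

theorem frobSq_add_of_orthogonal {A B : Matrix ι κ ℍ[ℝ]} (h : frobInner A B = 0) :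
    frobSq (A + B) = frobSq A + frobSq B := by
  rw [frobSq_add, h]
  ring

theorem frobSq_isometry_mul [DecidableEq α] {Q : Matrix ι α ℍ[ℝ]} (hQ : Qᴴ * Q = 1)
    (M : Matrix α κ ℍ[ℝ]) : frobSq (Q * M) = frobSq M := by
  rw [frobSq, frobInner_mul_left, ← Matrix.mul_assoc, hQ, Matrix.one_mul, frobSq]

theorem frobSq_mul_coisometry [DecidableEq α] {Q : Matrix ι α ℍ[ℝ]} (hQ : Qᴴ * Q = 1)
    (M : Matrix κ α ℍ[ℝ]) : frobSq (M * Qᴴ) = frobSq M := by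
  rw [← frobSq_conjTranspose, Matrix.conjTranspose_mul, Matrix.conjTranspose_conjTranspose,
    frobSq_isometry_mul hQ, frobSq_conjTranspose]

/-- Pythagoras for the orthogonal projection `Q * Qᴴ`. -/
theorem frobSq_eq_add_sub_proj [DecidableEq α] {Q : Matrix ι α ℍ[ℝ]} (hQ : Qᴴ * Q = 1)
    (M : Matrix ι κ ℍ[ℝ]) :
    frobSq M = frobSq (Qᴴ * M) + frobSq (M - Q * (Qᴴ * M)) := by
  have h : frobInner (Q * (Qᴴ * M)) (M - Q * (Qᴴ * M)) = 0 := by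
    rw [frobInner_mul_left, Matrix.mul_sub, ← Matrix.mul_assoc Qᴴ Q, hQ, Matrix.one_mul, sub_self,
      frobInner_zero_right]
  rw [← frobSq_isometry_mul hQ (Qᴴ * M), ← frobSq_add_of_orthogonal h, add_sub_cancel]

theorem frobSq_conjTranspose_mul_le [DecidableEq α] {Q : Matrix ι α ℍ[ℝ]} (hQ : Qᴴ * Q = 1)
    (M : Matrix ι κ ℍ[ℝ]) : frobSq (Qᴴ * M) ≤ frobSq M := by
  have := frobSq_eq_add_sub_proj hQ M
  have := frobSq_nonneg (M - Q * (Qᴴ * M))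
  linarith

/-- Least squares: `M` and `M - Q * N` have the same component orthogonal to the range of `Q`. -/
theorem frobSq_sub_proj_le [DecidableEq α] {Q : Matrix ι α ℍ[ℝ]} (hQ : Qᴴ * Q = 1)
    (M : Matrix ι κ ℍ[ℝ]) (N : Matrix α κ ℍ[ℝ]) :
    frobSq (M - Q * (Qᴴ * M)) ≤ frobSq (M - Q * N) := by
  have h := frobSq_eq_add_sub_proj hQ (M - Q * N)
  have e : M - Q * N - Q * (Qᴴ * (M - Q * N)) = M - Q * (Qᴴ * M) := by
    rw [Matrix.mul_sub Qᴴ, ← Matrix.mul_assoc Qᴴ Q, hQ, Matrix.one_mul, Matrix.mul_sub]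
    abel
  rw [e] at h
  have := frobSq_nonneg (Qᴴ * (M - Q * N))
  linarith

end FrobeniusInner

theorem frobNorm_eq_sqrt {m n : ℕ} (A : QMatrix m n) : frobNorm A = Real.sqrt (frobSq A) := by
  simp only [frobNorm, frobSq_eq_sum, Quaternion.normSq_def']

theorem frobNorm_nonneg {m n : ℕ} (A : QMatrix m n) : 0 ≤ frobNorm A := Real.sqrt_nonneg _

theorem sq_frobNorm {m n : ℕ} (A : QMatrix m n) : frobNorm A ^ 2 = frobSq A := by
  rw [frobNorm_eq_sqrt, Real.sq_sqrt (frobSq_nonneg A)]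

theorem frobNorm_le_iff {m n p q : ℕ} (A : QMatrix m n) (B : QMatrix p q) :
    frobNorm A ≤ frobNorm B ↔ frobSq A ≤ frobSq B := by
  rw [frobNorm_eq_sqrt, frobNorm_eq_sqrt, Real.sqrt_le_sqrt_iff (frobSq_nonneg _)]

theorem frobNorm_sub_comm {m n : ℕ} (A B : QMatrix m n) : frobNorm (A - B) = frobNorm (B - A) := by
  rw [frobNorm_eq_sqrt, frobNorm_eq_sqrt, frobSq_sub_comm]

theorem frobNorm_add_le {m n : ℕ} (A B : QMatrix m n) :
    frobNorm (A + B) ≤ frobNorm A + frobNorm B := by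
  let _ : NormedAddCommGroup (Matrix (Fin m) (Fin n) ℍ[ℝ]) := Matrix.frobeniusNormedAddCommGroup
  have h : ∀ M : QMatrix m n, frobNorm M = ‖M‖ := by
    intro M
    rw [Matrix.frobenius_norm_def, frobNorm_eq_sqrt, frobSq_eq_sum, Real.sqrt_eq_rpow]
    simp [Quaternion.normSq_eq_norm_mul_self, sq]
  rw [h, h, h]
  exact norm_add_le A B

/-! ### Orthonormal systems, full column rank and left inverses. -/

section Orthonormal

variable {ι κ α : Type*} [Fintype ι] [Fintype κ] [Fintype α]

/-- The sum of the squared norms of the entries of a vector. -/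
noncomputable def vecSq (x : ι → ℍ[ℝ]) : ℝ := ∑ i, Quaternion.normSq (x i)

theorem vecSq_nonneg (x : ι → ℍ[ℝ]) : 0 ≤ vecSq x :=
  Finset.sum_nonneg fun _ _ => Quaternion.normSq_nonneg

theorem vecSq_eq_zero {x : ι → ℍ[ℝ]} : vecSq x = 0 ↔ x = 0 := by
  rw [vecSq, Finset.sum_eq_zero_iff_of_nonneg fun _ _ => Quaternion.normSq_nonneg]
  simp [funext_iff]

theorem sum_star_mul_self (x : ι → ℍ[ℝ]) : ∑ i, star (x i) * x i = ((vecSq x : ℝ) : ℍ[ℝ]) := by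
  simp only [Quaternion.star_mul_self, vecSq]
  exact (map_sum (algebraMap ℝ ℍ[ℝ]) _ _).symm

theorem frobSq_eq_sum_vecSq (A : Matrix ι κ ℍ[ℝ]) : frobSq A = ∑ j, vecSq (fun i => A i j) := by
  rw [frobSq_eq_sum, Finset.sum_comm]
  rfl

/-- A quaternion matrix acting by left multiplication, as a real linear map. -/
noncomputable def realMulVec (M : Matrix ι κ ℍ[ℝ]) : (κ → ℍ[ℝ]) →ₗ[ℝ] (ι → ℍ[ℝ]) :=
  Matrix.mulVecBilin ℝ ℝ M

theorem finrank_vec : Module.finrank ℝ (ι → ℍ[ℝ]) = Fintype.card ι * 4 := by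
  rw [Module.finrank_pi_fintype]
  simp [Quaternion.finrank_eq_four]

/-- A count of real dimensions, four per quaternion coordinate; real linear algebra then suffices.
-/
theorem exists_ne_zero_mulVec_eq_zero (C : Matrix ι α ℍ[ℝ])
    (D : Matrix κ α ℍ[ℝ]) (h : Fintype.card ι + Fintype.card κ < Fintype.card α) :
    ∃ x : α → ℍ[ℝ], x ≠ 0 ∧ C *ᵥ x = 0 ∧ D *ᵥ x = 0 := by
  have hlt : Module.finrank ℝ ((ι → ℍ[ℝ]) × (κ → ℍ[ℝ])) < Module.finrank ℝ (α → ℍ[ℝ]) := by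
    rw [Module.finrank_prod, finrank_vec, finrank_vec, finrank_vec]
    omega
  obtain ⟨x, hx, hx0⟩ := Submodule.exists_mem_ne_zero_of_ne_bot
    (LinearMap.ker_ne_bot_of_finrank_lt (f := (realMulVec C).prod (realMulVec D)) hlt)
  rw [LinearMap.mem_ker] at hx
  exact ⟨x, hx0, congrArg Prod.fst hx, congrArg Prod.snd hx⟩

omit [Fintype ι] in
theorem mul_of_cons_apply {d : ℕ} (H : Matrix ι α ℍ[ℝ]) (x : α → ℍ[ℝ])
    (R : Matrix α (Fin d) ℍ[ℝ]) (i : ι) (j : Fin (d + 1)) :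
    (H * Matrix.of fun a => (Fin.cons (x a) (R a) : Fin (d + 1) → ℍ[ℝ])) i j =
      (Fin.cons ((H *ᵥ x) i) ((H * R) i) : Fin (d + 1) → ℍ[ℝ]) j := by
  refine Fin.cases ?_ (fun j => ?_) j <;> simp [Matrix.mul_apply, Matrix.mulVec, dotProduct]

/-- Gram-Schmidt with side conditions: if `H` has full column rank, one finds `d` vectors with
orthonormal images under `H` that are orthogonal to the columns of `C`. -/
theorem exists_orthonormal_image {H : Matrix ι α ℍ[ℝ]} (hH : ∀ x : α → ℍ[ℝ], H *ᵥ x = 0 → x = 0)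
    (C : Matrix α κ ℍ[ℝ]) (d : ℕ) (hd : Fintype.card κ + d ≤ Fintype.card α) :
    ∃ R : Matrix α (Fin d) ℍ[ℝ], (H * R)ᴴ * (H * R) = 1 ∧ Cᴴ * R = 0 := by
  induction d with
  | zero => exact ⟨Matrix.of fun _ j => j.elim0, by ext1 i; exact i.elim0, by ext1 _ j; exact j.elim0⟩
  | succ d ih =>
    obtain ⟨R, hR, hC⟩ := ih (by omega)
    -- The next vector must be orthogonal to the columns of `C`, and its image under `H` to the `d`
    -- images found so far: at most `card κ + d` conditions, fewer than the number of unknowns.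
    obtain ⟨x, hx0, hx1, hx2⟩ := exists_ne_zero_mulVec_eq_zero Cᴴ ((H * R)ᴴ * H)
      (by rw [Fintype.card_fin]; omega)
    have hpos : 0 < vecSq (H *ᵥ x) :=
      (vecSq_nonneg _).lt_of_ne fun h => hx0 (hH x (vecSq_eq_zero.1 h.symm))
    set c : ℝ := (Real.sqrt (vecSq (H *ᵥ x)))⁻¹ with hc
    set y : α → ℍ[ℝ] := c • x with hy
    have hCy : Cᴴ *ᵥ y = 0 := by rw [hy, Matrix.mulVec_smul, hx1, smul_zero]
    have hRy : (H * R)ᴴ *ᵥ (H *ᵥ y) = 0 := by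
      rw [Matrix.mulVec_mulVec, hy, Matrix.mulVec_smul, hx2, smul_zero]
    have hHy : vecSq (H *ᵥ y) = 1 := by
      have : vecSq (H *ᵥ y) = c ^ 2 * vecSq (H *ᵥ x) := by
        simp only [hy, Matrix.mulVec_smul, vecSq, Pi.smul_apply, Quaternion.normSq_smul,
          Finset.mul_sum]
      rw [this, hc, inv_pow, Real.sq_sqrt hpos.le, inv_mul_cancel₀ hpos.ne']
    refine ⟨Matrix.of fun a => (Fin.cons (y a) (R a) : Fin (d + 1) → ℍ[ℝ]), ?_, ?_⟩
    · ext1 i j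
      have key : ∀ k : Fin d, ∑ a, star ((H * R) a k) * (H *ᵥ y) a = 0 := fun k => by
        simpa [Matrix.mulVec, dotProduct] using congrFun hRy k
      rw [Matrix.mul_apply]
      simp only [Matrix.conjTranspose_apply, mul_of_cons_apply]
      refine Fin.cases ?_ (fun i => ?_) i <;> refine Fin.cases ?_ (fun j => ?_) j
      · simp [sum_star_mul_self, hHy]
      · have := congrArg star (key j)
        simpa [Matrix.one_apply, (Fin.succ_ne_zero j).symm] using this
      · simpa [Matrix.one_apply] using key i
      · have := congrFun (congrFun hR i) j
        rw [Matrix.mul_apply] at this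
        simpa [Matrix.one_apply, -Matrix.conjTranspose_mul] using this
    · ext1 i j
      rw [mul_of_cons_apply, hCy, hC]
      refine Fin.cases ?_ (fun j => ?_) j <;> simp

end Orthonormal

/-- The left inverse `(Mᴴ M)⁻¹ Mᴴ` of a matrix of full column rank. -/
noncomputable def leftInv {m n : ℕ} (M : QMatrix m n) : QMatrix n m :=
  Ring.inverse (Mᴴ * M) * Mᴴ

/-- A QR factorization: Gram-Schmidt without side conditions makes `H * R` an isometry. The left
inverse `(H * R)ᴴ * H` of `R` is two-sided because `R` is square. It reduces statements about `H` to
an orthonormal basis of its range. -/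
theorem FullColumnRank.exists_normalizer {m n : ℕ} {H : QMatrix m n} (hH : FullColumnRank H) :
    ∃ R R' : QMatrix n n, R * R' = 1 ∧ R' * R = 1 ∧ (H * R)ᴴ * (H * R) = 1 := by
  obtain ⟨R, hR, -⟩ := exists_orthonormal_image hH (0 : Matrix (Fin n) (Fin 0) ℍ[ℝ]) n (by simp)
  have h : (H * R)ᴴ * H * R = 1 := by rw [Matrix.mul_assoc, hR]
  exact ⟨R, (H * R)ᴴ * H, mul_eq_one_comm.1 h, h, hR⟩

theorem FullColumnRank.isUnit_gram {m n : ℕ} {H : QMatrix m n} (hH : FullColumnRank H) :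
    IsUnit (Hᴴ * H) := by
  obtain ⟨R, R', h1, -, h3⟩ := hH.exists_normalizer
  -- Conjugating the identity `Rᴴ Hᴴ H R = 1` by `R` exhibits the inverse of the Gram matrix.
  have h : R * Rᴴ * (Hᴴ * H) = 1 := by
    calc R * Rᴴ * (Hᴴ * H) = R * ((H * R)ᴴ * (H * R)) * R' := by
          simp only [Matrix.conjTranspose_mul, Matrix.mul_assoc, h1, Matrix.mul_one]
      _ = 1 := by rw [h3, Matrix.mul_one, h1]
  exact ⟨⟨_, _, mul_eq_one_comm.1 h, h⟩, rfl⟩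

theorem leftInv_mul_self {m n : ℕ} {M : QMatrix m n} (h : IsUnit (Mᴴ * M)) :
    leftInv M * M = 1 := by
  rw [leftInv, Matrix.mul_assoc, Ring.inverse_mul_cancel _ h]

theorem FullColumnRank.of_isUnit_gram {m n : ℕ} {M : QMatrix m n} (h : IsUnit (Mᴴ * M)) :
    FullColumnRank M := by
  intro x hx
  rw [← Matrix.one_mulVec x, ← leftInv_mul_self h, ← Matrix.mulVec_mulVec, hx, Matrix.mulVec_zero]

theorem isMoorePenrose_leftInv {m n : ℕ} {M : QMatrix m n} (h : IsUnit (Mᴴ * M)) :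
    IsMoorePenrose M (leftInv M) where
  mul_mul_self := by rw [Matrix.mul_assoc, leftInv_mul_self h, Matrix.mul_one]
  mul_mul_inv := by rw [leftInv_mul_self h, Matrix.one_mul]
  left_hermitian := by
    have hG : (Ring.inverse (Mᴴ * M))ᴴ = Ring.inverse (Mᴴ * M) := by
      rw [← Matrix.star_eq_conjTranspose, ← Ring.inverse_star, Matrix.star_eq_conjTranspose,
        Matrix.conjTranspose_mul, Matrix.conjTranspose_conjTranspose]
    rw [leftInv, Matrix.conjTranspose_mul, Matrix.conjTranspose_mul, hG,
      Matrix.conjTranspose_conjTranspose, Matrix.mul_assoc]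
  right_hermitian := by rw [leftInv_mul_self h, Matrix.conjTranspose_one]

theorem IsMoorePenrose.pinv_eq {m n : ℕ} {M : QMatrix m n} {X : QMatrix n m}
    (h : IsMoorePenrose M X) : pinv M = X := by
  have hex : ∃ X, IsMoorePenrose M X := ⟨X, h⟩
  rw [pinv, dif_pos hex]
  exact hex.choose_spec.unique h

theorem pinv_eq_leftInv {m n : ℕ} {M : QMatrix m n} (h : IsUnit (Mᴴ * M)) : pinv M = leftInv M :=
  (isMoorePenrose_leftInv h).pinv_eq

/-- An invertible change of columns keeps the range projection `M * leftInv M`, so `R * leftInv M`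
satisfies the Penrose equations for `M * R'`. With it the sketched inverse of `H` is rewritten
through that of an isometry. -/
theorem leftInv_mul_invertible {m n : ℕ} {M : QMatrix m n} (h : IsUnit (Mᴴ * M))
    {R R' : QMatrix n n} (h1 : R * R' = 1) (h2 : R' * R = 1) :
    IsUnit ((M * R')ᴴ * (M * R')) ∧ leftInv (M * R') = R * leftInv M := by
  have hu : IsUnit ((M * R')ᴴ * (M * R')) := by
    refine FullColumnRank.isUnit_gram fun x hx => ?_
    rw [← Matrix.mulVec_mulVec] at hx
    have := FullColumnRank.of_isUnit_gram h _ hx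
    rw [← Matrix.one_mulVec x, ← h1, ← Matrix.mulVec_mulVec, this, Matrix.mulVec_zero]
  refine ⟨hu, (isMoorePenrose_leftInv hu).unique ?_⟩
  have hP := isMoorePenrose_leftInv h
  have e1 : M * R' * (R * leftInv M) = M * leftInv M := by
    rw [Matrix.mul_assoc, ← Matrix.mul_assoc R', h2, Matrix.one_mul]
  have e2 : R * leftInv M * (M * R') = 1 := by
    rw [Matrix.mul_assoc, ← Matrix.mul_assoc _ M, leftInv_mul_self h, Matrix.one_mul, h1]
  exact ⟨by rw [Matrix.mul_assoc, e2, Matrix.mul_one], by rw [e2, Matrix.one_mul],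
    by rw [e1, hP.left_hermitian], by rw [e2, Matrix.conjTranspose_one]⟩

/-! ### Singular values and the condition number. -/

section SingularValues

theorem frobInner_vec {n : ℕ} (x y : Fin n → ℍ[ℝ]) :
    inner ℝ (WithLp.toLp 2 x) (WithLp.toLp 2 y) = ∑ i, (star (x i) * y i).re := by
  rw [PiLp.inner_apply]
  refine Finset.sum_congr rfl fun i _ => ?_
  rw [Quaternion.inner_def, ← Quaternion.re_star, star_mul, star_star, re_mul_comm]

theorem norm_toLp_sq {n : ℕ} (x : Fin n → ℍ[ℝ]) : ‖WithLp.toLp 2 x‖ ^ 2 = vecSq x := by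
  rw [PiLp.norm_sq_eq_of_L2, vecSq]
  simp [Quaternion.normSq_eq_norm_mul_self, sq]

/-- A square quaternion matrix as a real operator on a Euclidean space. -/
noncomputable def euclOp {n : ℕ} (S : QMatrix n n) :
    PiLp 2 (fun _ : Fin n => ℍ[ℝ]) →ₗ[ℝ] PiLp 2 (fun _ : Fin n => ℍ[ℝ]) :=
  (WithLp.linearEquiv 2 ℝ (Fin n → ℍ[ℝ])).symm.toLinearMap ∘ₗ realMulVec S ∘ₗ
    (WithLp.linearEquiv 2 ℝ (Fin n → ℍ[ℝ])).toLinearMap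

theorem euclOp_toLp {n : ℕ} (S : QMatrix n n) (x : Fin n → ℍ[ℝ]) :
    euclOp S (WithLp.toLp 2 x) = WithLp.toLp 2 (S *ᵥ x) := rfl

theorem sum_star_mul_gram {m n : ℕ} (H : QMatrix m n) (x y : Fin n → ℍ[ℝ]) :
    ∑ i, (star (x i) * ((Hᴴ * H) *ᵥ y) i).re = ∑ i, (star ((H *ᵥ x) i) * (H *ᵥ y) i).re := by
  rw [← re_sum, ← re_sum]
  have h1 : ∀ {k : ℕ} (u v : Fin k → ℍ[ℝ]), ∑ i, star (u i) * v i = star u ⬝ᵥ v := fun u v => rfl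
  rw [h1, h1, ← Matrix.mulVec_mulVec, Matrix.dotProduct_mulVec, Matrix.star_mulVec]

theorem vecSq_mulVec {m n : ℕ} (H : QMatrix m n) (x : Fin n → ℍ[ℝ]) :
    vecSq (H *ᵥ x) = inner ℝ (WithLp.toLp 2 x) (euclOp (Hᴴ * H) (WithLp.toLp 2 x)) := by
  rw [euclOp_toLp, frobInner_vec, sum_star_mul_gram, ← re_sum, sum_star_mul_self,
    Quaternion.re_coe]

theorem isSymmetric_euclOp_gram {m n : ℕ} (H : QMatrix m n) :
    (euclOp (Hᴴ * H)).IsSymmetric := by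
  intro x y
  change inner ℝ (WithLp.toLp 2 ((Hᴴ * H) *ᵥ x.ofLp)) (WithLp.toLp 2 y.ofLp) =
    inner ℝ (WithLp.toLp 2 x.ofLp) (WithLp.toLp 2 ((Hᴴ * H) *ᵥ y.ofLp))
  rw [real_inner_comm, frobInner_vec, frobInner_vec, sum_star_mul_gram, sum_star_mul_gram,
    ← frobInner_vec, ← frobInner_vec, real_inner_comm]

theorem hasEigenvalue_euclOp_iff {n : ℕ} (S : QMatrix n n) (c : ℝ) :
    Module.End.HasEigenvalue (euclOp S) c ↔ ∃ v : Fin n → ℍ[ℝ], v ≠ 0 ∧ S *ᵥ v = c • v := by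
  constructor
  · intro h
    obtain ⟨v, hv⟩ := h.exists_hasEigenvector
    refine ⟨v.ofLp, fun h0 => hv.2 (WithLp.ofLp_injective 2 h0), ?_⟩
    exact congrArg WithLp.ofLp hv.apply_eq_smul
  · rintro ⟨v, hv, h⟩
    refine Module.End.hasEigenvalue_of_hasEigenvector (x := WithLp.toLp 2 v)
      ⟨Module.End.mem_eigenspace_iff.2 ?_, fun h0 => hv (WithLp.toLp_injective 2 h0)⟩
    rw [euclOp_toLp, h]
    rfl

theorem finite_setOf_isSingularValue {m n : ℕ} (H : QMatrix m n) :
    {t | IsSingularValue H t}.Finite := by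
  refine Set.Finite.of_finite_image (f := fun t : ℝ => t ^ 2)
    (Set.Finite.subset (Module.End.finite_hasEigenvalue (euclOp (Hᴴ * H))) ?_) ?_
  · rintro _ ⟨t, ht, rfl⟩
    exact (hasEigenvalue_euclOp_iff _ _).2 ht.2
  · intro s hs t ht h
    exact (sq_eq_sq₀ hs.1 ht.1).1 h

/-- Regarded as a real operator, `Hᴴ * H` is symmetric. In a real orthonormal eigenbasis `vecSq (H
*ᵥ x)` is the sum of the squared coordinates of `x` weighted by eigenvalues, each the square of a
singular value. -/
theorem vecSq_bounds_of_singularValues {m n : ℕ} (H : QMatrix m n) {a b : ℝ}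
    (ha : ∀ t, IsSingularValue H t → a ≤ t ^ 2) (hb : ∀ t, IsSingularValue H t → t ^ 2 ≤ b)
    (x : Fin n → ℍ[ℝ]) :
    a * vecSq x ≤ vecSq (H *ᵥ x) ∧ vecSq (H *ᵥ x) ≤ b * vecSq x := by
  have hs := isSymmetric_euclOp_gram H
  set e := hs.eigenvectorBasis rfl with he
  have hsv : ∀ i, 0 ≤ hs.eigenvalues rfl i ∧
      IsSingularValue H (Real.sqrt (hs.eigenvalues rfl i)) := by
    intro i
    obtain ⟨v, hv, hv2⟩ := (hasEigenvalue_euclOp_iff _ _).1 (hs.hasEigenvalue_eigenvalues rfl i)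
    have h0 : 0 ≤ hs.eigenvalues rfl i := by
      have h1 := vecSq_mulVec H v
      rw [euclOp_toLp, hv2, WithLp.toLp_smul, inner_smul_right, real_inner_self_eq_norm_sq,
        norm_toLp_sq] at h1
      have h2 : 0 < vecSq v := (vecSq_nonneg v).lt_of_ne fun h => hv (vecSq_eq_zero.1 h.symm)
      exact nonneg_of_mul_nonneg_left (h1 ▸ vecSq_nonneg _) h2
    exact ⟨h0, Real.sqrt_nonneg _, v, hv, by rw [Real.sq_sqrt h0]; exact hv2⟩
  have hx : vecSq x = ∑ i, (inner ℝ (e i) (WithLp.toLp 2 x)) ^ 2 := by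
    rw [← norm_toLp_sq, ← e.sum_sq_norm_inner_right]
    simp
  have hHx : vecSq (H *ᵥ x) =
      ∑ i, hs.eigenvalues rfl i * (inner ℝ (e i) (WithLp.toLp 2 x)) ^ 2 := by
    rw [vecSq_mulVec, ← e.sum_inner_mul_inner]
    refine Finset.sum_congr rfl fun i _ => ?_
    rw [← hs, hs.apply_eigenvectorBasis, inner_smul_left, real_inner_comm]
    simp only [RCLike.conj_to_real, RCLike.ofReal_real_eq_id, id]
    ring
  rw [hx, hHx, Finset.mul_sum, Finset.mul_sum]
  constructor <;> refine Finset.sum_le_sum fun i _ => mul_le_mul_of_nonneg_right ?_ (sq_nonneg _)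
  · simpa [Real.sq_sqrt (hsv i).1] using ha _ (hsv i).2
  · simpa [Real.sq_sqrt (hsv i).1] using hb _ (hsv i).2

theorem exists_isSingularValue {m n : ℕ} (hn : 0 < n) (H : QMatrix m n) :
    ∃ t, IsSingularValue H t := by
  by_contra! h
  -- Without singular values both bounds hold vacuously, even with `a = 1 > b = 0`; the all-ones
  -- vector refutes this.
  have := vecSq_bounds_of_singularValues H (a := 1) (b := 0) (fun t ht => (h t ht).elim)
    (fun t ht => (h t ht).elim) (fun _ => 1)
  have h3 : vecSq (fun _ : Fin n => (1 : ℍ[ℝ])) = n := by simp [vecSq]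
  rw [h3] at this
  have h4 : (0 : ℝ) < n := by exact_mod_cast hn
  linarith

/-- The condition number is the ratio of the optimal constants in the norm comparison. -/
theorem FullColumnRank.condNum_spec {m n : ℕ} {H : QMatrix m n} (hH : FullColumnRank H)
    (hn : 0 < n) : ∃ a b : ℝ, 0 < a ∧ 0 ≤ b ∧ condNum H = b / a ∧
      ∀ x, a ^ 2 * vecSq x ≤ vecSq (H *ᵥ x) ∧ vecSq (H *ᵥ x) ≤ b ^ 2 * vecSq x := by
  set S := {t | IsSingularValue H t} with hS
  have hfin : S.Finite := finite_setOf_isSingularValue H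
  have hne : S.Nonempty := exists_isSingularValue hn H
  have ha : sInf S ∈ S := hne.csInf_mem hfin
  have hb : sSup S ∈ S := hne.csSup_mem hfin
  refine ⟨sInf S, sSup S, ha.1.lt_of_ne fun h0 => ?_, hb.1, rfl,
    vecSq_bounds_of_singularValues H (fun t ht => ?_) fun t ht => ?_⟩
  -- A zero singular value would give a kernel vector of `Hᴴ * H`, whose own Gram matrix is a
  -- product of two units.
  · obtain ⟨v, hv, h⟩ := ha.2
    apply hv
    rw [← h0, zero_pow two_ne_zero, zero_smul] at h
    exact FullColumnRank.of_isUnit_gram (M := Hᴴ * H)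
      (by rw [Matrix.conjTranspose_mul, Matrix.conjTranspose_conjTranspose]
          exact hH.isUnit_gram.mul hH.isUnit_gram) v h
  · exact pow_le_pow_left₀ ha.1 (csInf_le hfin.bddBelow ht) 2
  · exact pow_le_pow_left₀ ht.1 (le_csSup hfin.bddAbove ht) 2

theorem condNum_nonneg {m n : ℕ} (H : QMatrix m n) : 0 ≤ condNum H :=
  div_nonneg (Real.sSup_nonneg fun _ ht => ht.1) (Real.sInf_nonneg fun _ ht => ht.1)

theorem frobSq_mul_eq_sum_vecSq {m n k : ℕ} (H : QMatrix m n) (M : QMatrix n k) :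
    frobSq (H * M) = ∑ j, vecSq (H *ᵥ fun i => M i j) := by
  rw [frobSq_eq_sum_vecSq]
  rfl

end SingularValues

/-! ### Eckart-Young and the deterministic truncation error. -/

section EckartYoung

theorem rectDiag_conjTranspose (m n : ℕ) (σ : ℕ → ℝ) : (rectDiag m n σ)ᴴ = rectDiag n m σ := by
  ext1 i j
  simp only [rectDiag, Matrix.conjTranspose_apply, Matrix.of_apply]
  by_cases h : (i : ℕ) = j
  · simp [h]
  · simp [h, Ne.symm h]

theorem rectDiag_mul_apply {m n k : ℕ} (σ : ℕ → ℝ) (M : QMatrix n k) (i : Fin m) (j : Fin k) :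
    (rectDiag m n σ * M) i j = if h : (i : ℕ) < n then (σ i : ℍ[ℝ]) * M ⟨i, h⟩ j else 0 := by
  simp only [Matrix.mul_apply, rectDiag, Matrix.of_apply]
  split_ifs with h
  · rw [Finset.sum_eq_single (⟨i, h⟩ : Fin n)]
    · simp
    · intro b _ hb
      have : (i : ℕ) ≠ b := fun h => hb (Fin.ext h.symm)
      simp [this]
    · simp
  · refine Finset.sum_eq_zero fun b _ => ?_
    have : (i : ℕ) ≠ b := by omega
    simp [this]

theorem rectDiag_mul_rectDiag (m n k : ℕ) (σ τ : ℕ → ℝ) :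
    rectDiag m n σ * rectDiag n k τ = rectDiag m k fun i => if i < n then σ i * τ i else 0 := by
  ext1 i j
  rw [rectDiag_mul_apply]
  simp only [rectDiag, Matrix.of_apply]
  split_ifs <;> simp

theorem rectDiag_sub (m n : ℕ) (σ τ : ℕ → ℝ) :
    rectDiag m n σ - rectDiag m n τ = rectDiag m n fun i => σ i - τ i := by
  ext1 i j
  simp only [rectDiag, Matrix.sub_apply, Matrix.of_apply]
  split_ifs <;> simp

theorem frobSq_rectDiag_mul {m n k : ℕ} (h : m ≤ n) (σ : ℕ → ℝ) (M : QMatrix n k) :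
    frobSq (rectDiag m n σ * M) =
      ∑ i : Fin m, σ i ^ 2 * ∑ j, Quaternion.normSq (M (Fin.castLE h i) j) := by
  rw [frobSq_eq_sum]
  refine Finset.sum_congr rfl fun i _ => ?_
  rw [Finset.mul_sum]
  refine Finset.sum_congr rfl fun j _ => ?_
  rw [rectDiag_mul_apply, dif_pos (i.2.trans_le h), map_mul, Quaternion.normSq_coe]
  rfl

theorem frobSq_rectDiag {m n : ℕ} (h : m ≤ n) (σ : ℕ → ℝ) :
    frobSq (rectDiag m n σ) = ∑ i : Fin m, σ i ^ 2 := by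
  rw [← Matrix.mul_one (rectDiag m n σ), frobSq_rectDiag_mul h]
  refine Finset.sum_congr rfl fun i _ => ?_
  rw [Finset.sum_eq_single (Fin.castLE h i)]
  · simp
  · intro b _ hb
    simp [hb.symm]
  · simp

theorem frobSq_of_isometry {n r : ℕ} {W : QMatrix n r} (hW : Wᴴ * W = 1) : frobSq W = r := by
  simp [frobSq, frobInner, hW, Matrix.trace]

/-- Row `k` has the norm of `Wᴴ e_k`, and the adjoint of an isometry is a contraction. -/
theorem sum_normSq_row_le_one {n r : ℕ} {W : QMatrix n r} (hW : Wᴴ * W = 1) (k : Fin n) :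
    ∑ j, Quaternion.normSq (W k j) ≤ 1 := by
  set e : QMatrix n 1 := Matrix.of fun i _ => if i = k then 1 else 0 with he
  have h := frobSq_conjTranspose_mul_le hW e
  have h1 : frobSq e = 1 := by
    rw [frobSq_eq_sum, Finset.sum_eq_single k] <;> simp +contextual [he]
  have h2 : frobSq (Wᴴ * e) = ∑ j, Quaternion.normSq (W k j) := by
    rw [frobSq_eq_sum]
    refine Finset.sum_congr rfl fun j _ => ?_
    simp [Matrix.mul_apply, he]
  rwa [h1, h2] at h

/-- Among weights in `[0, 1]` of total mass at most `r`, the first `r` indices maximize the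
weighted sum of an antitone sequence. -/
theorem sum_mul_weights_le {n r : ℕ} (hr : r ≤ n) {c : ℕ → ℝ} (hc : Antitone c)
    (hc0 : ∀ i, 0 ≤ c i) (w : Fin n → ℝ) (hw0 : ∀ i, 0 ≤ w i) (hw1 : ∀ i, w i ≤ 1)
    (hw : ∑ i, w i ≤ r) : ∑ i : Fin n, c i * w i ≤ ∑ i : Fin n, if (i : ℕ) < r then c i else 0 := by
  have hcard : ∑ i : Fin n, (if (i : ℕ) < r then (1 : ℝ) else 0) = r := by
    rw [Fin.sum_univ_eq_sum_range (fun i => if i < r then (1 : ℝ) else 0) n, ← Finset.sum_filter]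
    have : (Finset.range n).filter (· < r) = Finset.range r := by
      ext i
      simp only [Finset.mem_filter, Finset.mem_range]
      omega
    simp [this]
  -- With `c r` as threshold, `(c i - c r) * (w i - 1_{i < r}) ≤ 0` for every `i`: the two factors
  -- have opposite signs.
  have h1 : ∀ i : Fin n, c i * w i - (if (i : ℕ) < r then c i else 0) ≤
      c r * (w i - if (i : ℕ) < r then (1 : ℝ) else 0) := by
    intro i
    split_ifs with hi
    · have := hc hi.le
      nlinarith [hw1 i]
    · have := hc (not_lt.1 hi)
      nlinarith [hw0 i]
  have h2 := Finset.sum_le_sum fun i (_ : i ∈ Finset.univ) => h1 i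
  rw [← Finset.mul_sum, Finset.sum_sub_distrib, Finset.sum_sub_distrib, hcard] at h2
  have := mul_nonneg (hc0 r) (sub_nonneg.2 hw)
  linarith

/-- A Ky Fan type bound. Once the unitary factors are removed, the left side is a weighted sum of
the `σ i ^ 2`; the weights are squared row norms of the isometry `Vᴴ * W`, hence at most one each
and at most `r` in total. -/
theorem IsQSVD.frobSq_mul_le {m n r : ℕ} (hmn : m ≤ n) (hr : r ≤ m) {X : QMatrix m n}
    {U : QMatrix m m} {σ : ℕ → ℝ} {V : QMatrix n n} (h : IsQSVD X U σ V) {W : QMatrix n r}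
    (hW : Wᴴ * W = 1) :
    frobSq (X * W) ≤ ∑ i : Fin m, if (i : ℕ) < r then σ i ^ 2 else 0 := by
  have hVW : (Vᴴ * W)ᴴ * (Vᴴ * W) = 1 := by
    rw [Matrix.conjTranspose_mul, Matrix.conjTranspose_conjTranspose, Matrix.mul_assoc,
      ← Matrix.mul_assoc V, h.right_unitary.2, Matrix.one_mul, hW]
  rw [h.eq_mul, Matrix.mul_assoc, Matrix.mul_assoc, frobSq_isometry_mul h.left_unitary.1,
    frobSq_rectDiag_mul hmn]
  refine sum_mul_weights_le hr (c := fun i => σ i ^ 2)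
    (fun i j hij => pow_le_pow_left₀ (h.nonneg j) (h.antitone hij) 2) (fun i => sq_nonneg _)
    (fun i => ∑ j, Quaternion.normSq ((Vᴴ * W) (Fin.castLE hmn i) j))
    (fun i => Finset.sum_nonneg fun j _ => Quaternion.normSq_nonneg)
    (fun i => sum_normSq_row_le_one hVW _) ?_
  rw [← frobSq_of_isometry hVW, frobSq_eq_sum]
  have hinj : Function.Injective (Fin.castLE hmn) := Fin.castLE_injective hmn
  rw [← Finset.sum_image (f := fun k => ∑ j, Quaternion.normSq ((Vᴴ * W) k j)) (hinj.injOn)]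
  exact Finset.sum_le_sum_of_subset_of_nonneg (Finset.subset_univ _)
    fun i _ _ => Finset.sum_nonneg fun j _ => Quaternion.normSq_nonneg

theorem IsQSVD.frobSq_eq {m n : ℕ} (hmn : m ≤ n) {X : QMatrix m n}
    {U : QMatrix m m} {σ : ℕ → ℝ} {V : QMatrix n n} (h : IsQSVD X U σ V) :
    frobSq X = ∑ i : Fin m, σ i ^ 2 := by
  rw [h.eq_mul, frobSq_mul_coisometry h.right_unitary.1, frobSq_isometry_mul h.left_unitary.1,
    frobSq_rectDiag hmn]

/-- Eckart-Young-Mirsky in the Frobenius norm: the truncated decomposition is at least as close to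
`X` as any matrix whose row space has dimension at most `r`. -/
theorem IsTruncatedQSVD.frobSq_sub_le {m n r : ℕ} (hmn : m ≤ n) (hr : r ≤ m) {X T : QMatrix m n}
    (h : IsTruncatedQSVD r X T) {W : QMatrix n r} (hW : Wᴴ * W = 1) (Z : QMatrix m r) :
    frobSq (X - T) ≤ frobSq (X - Z * Wᴴ) := by
  obtain ⟨U, σ, V, hX, rfl⟩ := h
  have h1 : frobSq (X - U * rectDiag m n (fun i => if i < r then σ i else 0) * Vᴴ) =
      frobSq X - ∑ i : Fin m, if (i : ℕ) < r then σ i ^ 2 else 0 := by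
    have : X - U * rectDiag m n (fun i => if i < r then σ i else 0) * Vᴴ =
        U * rectDiag m n (fun i => σ i - if i < r then σ i else 0) * Vᴴ := by
      rw [hX.eq_mul, ← rectDiag_sub, Matrix.mul_sub, Matrix.sub_mul]
    rw [this, hX.frobSq_eq hmn, frobSq_mul_coisometry hX.right_unitary.1,
      frobSq_isometry_mul hX.left_unitary.1, frobSq_rectDiag hmn, ← Finset.sum_sub_distrib]
    refine Finset.sum_congr rfl fun i _ => ?_
    split_ifs <;> simp
  -- For given `W` the best `Z` is `X * W`. Since `W` acts from the right, the projection lemmas are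
  -- applied to adjoints.
  have h2 : frobSq X - frobSq (X * W) ≤ frobSq (X - Z * Wᴴ) := by
    have e1 := frobSq_sub_proj_le hW Xᴴ Zᴴ
    have e2 := frobSq_eq_add_sub_proj hW Xᴴ
    have e3 : frobSq (Wᴴ * Xᴴ) = frobSq (X * W) := by
      rw [← Matrix.conjTranspose_mul, frobSq_conjTranspose]
    have e4 : frobSq (Xᴴ - W * Zᴴ) = frobSq (X - Z * Wᴴ) := by
      rw [← frobSq_conjTranspose (X - Z * Wᴴ), Matrix.conjTranspose_sub, Matrix.conjTranspose_mul,
        Matrix.conjTranspose_conjTranspose]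
    rw [e3, frobSq_conjTranspose] at e2
    rw [e4] at e1
    linarith
  rw [h1]
  linarith [hX.frobSq_mul_le hmn hr hW]

/-- The leading `r` right singular vectors. -/
noncomputable def leadingCols {n : ℕ} (r : ℕ) (V : QMatrix n n) : QMatrix n r :=
  V * rectDiag n r fun _ => 1

theorem leadingCols_isometry {n r : ℕ} (hr : r ≤ n) {V : QMatrix n n} (hV : Vᴴ * V = 1) :
    (leadingCols r V)ᴴ * leadingCols r V = 1 := by
  rw [leadingCols, Matrix.conjTranspose_mul, Matrix.mul_assoc, ← Matrix.mul_assoc Vᴴ, hV,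
    Matrix.one_mul, rectDiag_conjTranspose, rectDiag_mul_rectDiag]
  ext1 i j
  have : (i : ℕ) < n := i.2.trans_le hr
  simp [rectDiag, this, Matrix.one_apply, Fin.ext_iff]

/-- Projecting onto the leading right singular vectors keeps exactly the first `r` singular values,
so the residual is the tail. The condition `i < n ∧ i < r` records the two inner dimensions of the
product of diagonal factors. -/
theorem IsQSVD.frobSq_sub_leadingCols {m n r : ℕ} (hnm : n ≤ m) (hr : r ≤ n) {A : QMatrix m n}
    {U : QMatrix m m} {σ : ℕ → ℝ} {V : QMatrix n n} (h : IsQSVD A U σ V) :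
    frobSq (A - A * leadingCols r V * (leadingCols r V)ᴴ) = tailNorm r n σ ^ 2 := by
  have e : A - A * leadingCols r V * (leadingCols r V)ᴴ =
      U * rectDiag m n (fun i => σ i - if i < n ∧ i < r then σ i else 0) * Vᴴ := by
    rw [← rectDiag_sub, Matrix.mul_sub, Matrix.sub_mul]
    conv_lhs => rw [h.eq_mul]
    congr 1
    rw [leadingCols, Matrix.conjTranspose_mul, rectDiag_conjTranspose]
    have : rectDiag m n (fun i => if i < n ∧ i < r then σ i else 0) =
        rectDiag m n σ * rectDiag n r (fun _ => 1) * rectDiag r n (fun _ => 1) := by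
      rw [rectDiag_mul_rectDiag, rectDiag_mul_rectDiag]
      congr 1
      ext i
      by_cases h1 : i < n <;> by_cases h2 : i < r <;> simp [h1, h2]
    rw [this]
    simp only [Matrix.mul_assoc]
    rw [← Matrix.mul_assoc Vᴴ V, h.right_unitary.1, Matrix.one_mul]
  rw [e, frobSq_mul_coisometry h.right_unitary.1, frobSq_isometry_mul h.left_unitary.1,
    ← frobSq_conjTranspose, rectDiag_conjTranspose, frobSq_rectDiag hnm, tailNorm,
    Real.sq_sqrt (Finset.sum_nonneg fun _ _ => sq_nonneg _),
    Fin.sum_univ_eq_sum_range (fun i => (σ i - if i < n ∧ i < r then σ i else 0) ^ 2),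
    Finset.range_eq_Ico, ← Finset.sum_Ico_consecutive _ (Nat.zero_le r) hr,
    Finset.sum_eq_zero, zero_add]
  · refine Finset.sum_congr rfl fun i hi => ?_
    have := (Finset.mem_Ico.1 hi).1
    simp [not_lt.2 this]
  · intro i hi
    have := (Finset.mem_Ico.1 hi).2
    simp [this, this.trans_le hr]

/-- The error of the truncated approximation in terms of the error of the untruncated one. -/
theorem frobNorm_mul_truncated_sub_le {m n s r : ℕ} (hrs : r ≤ s) (hsn : s ≤ n)
    {H : QMatrix m s} (hH : FullColumnRank H) (A : QMatrix m n) {W : QMatrix n r}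
    (hW : Wᴴ * W = 1) {X T : QMatrix s n} (hT : IsTruncatedQSVD r X T) :
    frobNorm (H * T - A) ≤ (1 + condNum H) * frobNorm (H * X - A) +
      condNum H * frobNorm (A - A * W * Wᴴ) := by
  have hκ := condNum_nonneg H
  -- For `s = 0` there are no singular values to compare, but `X` and `T` are both empty.
  rcases Nat.eq_zero_or_pos s with rfl | hs
  · have : T = X := by
      ext1 i
      exact i.elim0
    rw [this]
    nlinarith [frobNorm_nonneg (H * X - A), frobNorm_nonneg (A - A * W * Wᴴ)]
  obtain ⟨a, b, ha, hb, hab, hbd⟩ := hH.condNum_spec hs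
  obtain ⟨R, R', h1, h2, h3⟩ := hH.exists_normalizer
  set Q := H * R with hQ
  have hHQ : Q * (Qᴴ * H) = H := by
    have : H = Q * R' := by rw [hQ, Matrix.mul_assoc, h1, Matrix.mul_one]
    nth_rw 1 [this]
    rw [← Matrix.mul_assoc Qᴴ, h3, Matrix.one_mul, ← this]
  have hlow : ∀ M : QMatrix s n, a * frobNorm M ≤ frobNorm (H * M) := by
    intro M
    refine abs_le_of_sq_le_sq' ?_ (frobNorm_nonneg _) |>.2
    rw [mul_pow, sq_frobNorm, sq_frobNorm, frobSq_mul_eq_sum_vecSq, frobSq_eq_sum_vecSq,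
      Finset.mul_sum]
    exact Finset.sum_le_sum fun j _ => (hbd _).1
  have hup : ∀ M : QMatrix s n, frobNorm (H * M) ≤ b * frobNorm M := by
    intro M
    refine abs_le_of_sq_le_sq' ?_ (mul_nonneg hb (frobNorm_nonneg _)) |>.2
    rw [mul_pow, sq_frobNorm, sq_frobNorm, frobSq_mul_eq_sum_vecSq, frobSq_eq_sum_vecSq,
      Finset.mul_sum]
    exact Finset.sum_le_sum fun j _ => (hbd _).2
  -- Chosen so that `H * Z` is the orthogonal projection of `A * W` onto the range of `H`.
  set Z : QMatrix s r := R * (Qᴴ * (A * W)) with hZ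
  have e1 : frobNorm (X - T) ≤ frobNorm (X - Z * Wᴴ) :=
    (frobNorm_le_iff _ _).2 (hT.frobSq_sub_le hsn hrs hW Z)
  have e2 : frobNorm (H * (X - Z * Wᴴ)) ≤ frobNorm (H * X - A * W * Wᴴ) := by
    have : H * (X - Z * Wᴴ) = Q * (Qᴴ * (H * X - A * W * Wᴴ)) := by
      rw [Matrix.mul_sub, Matrix.mul_sub, Matrix.mul_sub]
      congr 1
      · rw [← Matrix.mul_assoc Qᴴ, ← Matrix.mul_assoc Q, hHQ]
      · simp only [hZ, hQ, Matrix.mul_assoc]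
    rw [this, frobNorm_le_iff, frobSq_isometry_mul h3]
    exact frobSq_conjTranspose_mul_le h3 _
  have e3 : frobNorm (H * X - A * W * Wᴴ) ≤
      frobNorm (H * X - A) + frobNorm (A - A * W * Wᴴ) := by
    have := frobNorm_add_le (H * X - A) (A - A * W * Wᴴ)
    rwa [sub_add_sub_cancel] at this
  have e4 : frobNorm (H * T - A) ≤ frobNorm (H * (X - T)) + frobNorm (H * X - A) := by
    have := frobNorm_add_le (H * (T - X)) (H * X - A)
    rw [Matrix.mul_sub, sub_add_sub_cancel] at this
    rwa [Matrix.mul_sub, frobNorm_sub_comm (H * X)]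
  -- Optimality of `T` is available only in the coordinates of `X`; comparing there and returning
  -- through `H` costs `b / a`, the condition number.
  have e5 : frobNorm (X - T) ≤ (frobNorm (H * X - A) + frobNorm (A - A * W * Wᴴ)) / a := by
    rw [le_div_iff₀ ha, mul_comm]
    exact (mul_le_mul_of_nonneg_left e1 ha.le).trans ((hlow _).trans (e2.trans e3))
  have e6 : frobNorm (H * (X - T)) ≤
      condNum H * (frobNorm (H * X - A) + frobNorm (A - A * W * Wᴴ)) := by
    refine (hup _).trans ((mul_le_mul_of_nonneg_left e5 hb).trans_eq ?_)
    rw [hab]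
    ring
  linarith

end EckartYoung

/-! ### The mean of the inverse of a chi-squared variable. -/

section InverseMoment

/-- The Laplace representation turns the inverse of a sum of squares into exponentials, which factor
over coordinates. In extended nonnegative reals it also covers `S = 0`, both sides being infinite.
-/
theorem inv_ofReal_eq_lintegral_exp {S : ℝ} (hS : 0 ≤ S) :
    (ENNReal.ofReal S)⁻¹ = ∫⁻ t in Set.Ioi (0 : ℝ), ENNReal.ofReal (Real.exp (-S * t)) := by
  rcases hS.eq_or_lt with rfl | hS
  · simp
  · rw [← ofReal_integral_eq_lintegral_ofReal (exp_neg_integrableOn_Ioi 0 hS)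
      (Filter.Eventually.of_forall fun _ => (Real.exp_pos _).le),
      integral_exp_mul_Ioi (neg_lt_zero.2 hS), ← ENNReal.ofReal_inv_of_pos hS]
    congr 1
    simp [neg_div_neg_eq]

theorem integral_exp_neg_mul_sq_gaussianReal {t : ℝ} (ht : 0 ≤ t) :
    ∫ x, Real.exp (-t * x ^ 2) ∂gaussianReal 0 1 = (1 + 2 * t) ^ (-(1 / 2 : ℝ)) := by
  have e : ∀ x : ℝ, gaussianPDFReal 0 1 x • Real.exp (-t * x ^ 2) =
      (√(2 * Real.pi))⁻¹ * Real.exp (-(1 / 2 + t) * x ^ 2) := by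
    intro x
    rw [gaussianPDFReal_def]
    simp only [NNReal.coe_one, mul_one, sub_zero, smul_eq_mul]
    rw [mul_assoc, ← Real.exp_add]
    congr 2
    ring
  rw [integral_gaussianReal_eq_integral_smul one_ne_zero]
  simp only [e]
  rw [integral_const_mul, integral_gaussian, ← Real.sqrt_inv, ← Real.sqrt_mul (by positivity),
    Real.rpow_neg (by positivity), ← Real.sqrt_eq_rpow, ← Real.sqrt_inv]
  congr 1
  have := Real.pi_pos
  field_simp

theorem lintegral_rpow_one_add_two_mul {p : ℝ} (hp : 1 < p) :
    ∫⁻ t in Set.Ioi (0 : ℝ), ENNReal.ofReal ((1 + 2 * t) ^ (-p)) =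
      ENNReal.ofReal (1 / (2 * (p - 1))) := by
  have hpos : ∀ t ∈ Set.Ici (0 : ℝ), 0 < 1 + 2 * t := fun t ht => by
    have : 0 ≤ t := ht
    linarith
  -- The antiderivative vanishing at infinity; `1 < p` makes its exponent negative.
  set g : ℝ → ℝ := fun t => -(1 / (2 * (p - 1))) * (1 + 2 * t) ^ (-(p - 1)) with hg
  have hd : ∀ t ∈ Set.Ici (0 : ℝ), HasDerivAt g ((1 + 2 * t) ^ (-p)) t := by
    intro t ht
    have h1 : HasDerivAt (fun t : ℝ => 1 + 2 * t) 2 t := by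
      simpa using ((hasDerivAt_id t).const_mul 2).const_add 1
    have h2 := (h1.rpow_const (p := -(p - 1)) (Or.inl (hpos t ht).ne')).const_mul
      (-(1 / (2 * (p - 1))))
    have : p - 1 ≠ 0 := by linarith
    refine h2.congr_deriv ?_
    rw [show -(p - 1) - 1 = -p by ring]
    field_simp
  have hc : ContinuousWithinAt g (Set.Ici 0) 0 :=
    (hd 0 Set.self_mem_Ici).continuousAt.continuousWithinAt
  have hlim : Filter.Tendsto g Filter.atTop (nhds 0) := by
    have h1 : Filter.Tendsto (fun t : ℝ => 1 + 2 * t) Filter.atTop Filter.atTop :=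
      Filter.tendsto_atTop_add_const_left _ _ (Filter.tendsto_id.const_mul_atTop two_pos)
    have h2 := ((tendsto_rpow_neg_atTop (sub_pos.2 hp)).comp h1).const_mul (-(1 / (2 * (p - 1))))
    rwa [mul_zero] at h2
  have hnn : ∀ t ∈ Set.Ioi (0 : ℝ), 0 ≤ (1 + 2 * t) ^ (-p) := fun t ht =>
    Real.rpow_nonneg (hpos t (Set.Ioi_subset_Ici_self ht)).le _
  have hd' := fun t (ht : t ∈ Set.Ioi (0 : ℝ)) => hd t (Set.Ioi_subset_Ici_self ht)
  have hi := integrableOn_Ioi_deriv_of_nonneg hc hd' hnn hlim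
  rw [← ofReal_integral_eq_lintegral_ofReal hi
    ((ae_restrict_iff' measurableSet_Ioi).2 (Filter.Eventually.of_forall hnn)),
    integral_Ioi_of_hasDerivAt_of_tendsto hc hd' hi hlim]
  congr 1
  simp [hg]

/-- The inverse second moment of the norm of a standard Gaussian vector in dimension at least
three. -/
theorem lintegral_inv_sum_sq_pi_gaussianReal {ι : Type*} [Fintype ι] (h : 2 < Fintype.card ι) :
    ∫⁻ x, (ENNReal.ofReal (∑ i, x i ^ 2))⁻¹ ∂Measure.pi (fun _ : ι => gaussianReal 0 1) =
      ENNReal.ofReal (1 / ((Fintype.card ι : ℝ) - 2)) := by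
  have hk : (2 : ℝ) < Fintype.card ι := by exact_mod_cast h
  simp only [fun x : ι → ℝ => inv_ofReal_eq_lintegral_exp
    (Finset.sum_nonneg fun i (_ : i ∈ Finset.univ) => sq_nonneg (x i))]
  rw [lintegral_lintegral_swap (by
    refine Measurable.aemeasurable ?_
    unfold Function.uncurry
    fun_prop)]
  -- After Tonelli the inner integral is a product of equal one-dimensional Gaussian integrals. The
  -- exponent `card ι / 2` exceeds one exactly when the dimension exceeds two.
  have hin : ∀ t ∈ Set.Ioi (0 : ℝ),
      ∫⁻ x : ι → ℝ, ENNReal.ofReal (Real.exp (-(∑ i, x i ^ 2) * t))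
        ∂Measure.pi (fun _ : ι => gaussianReal 0 1) =
      ENNReal.ofReal ((1 + 2 * t) ^ (-((Fintype.card ι : ℝ) / 2))) := by
    intro t ht
    have ht0 : 0 < t := ht
    have e : ∀ x : ι → ℝ, Real.exp (-(∑ i, x i ^ 2) * t) = ∏ i, Real.exp (-t * x i ^ 2) := by
      intro x
      rw [← Real.exp_sum, ← Finset.mul_sum]
      congr 1
      ring
    have hle : ∀ x : ι → ℝ, ‖Real.exp (-(∑ i, x i ^ 2) * t)‖ ≤ 1 := by
      intro x
      rw [Real.norm_of_nonneg (Real.exp_pos _).le, Real.exp_le_one_iff]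
      have := Finset.sum_nonneg fun i (_ : i ∈ Finset.univ) => sq_nonneg (x i)
      nlinarith
    rw [← ofReal_integral_eq_lintegral_ofReal
      (Integrable.of_bound (Measurable.aestronglyMeasurable (by fun_prop)) 1 (Filter.Eventually.of_forall hle))
      (Filter.Eventually.of_forall fun _ => (Real.exp_pos _).le)]
    simp only [e]
    rw [integral_fintype_prod_eq_prod (f := fun _ x => Real.exp (-t * x ^ 2))]
    simp only [integral_exp_neg_mul_sq_gaussianReal ht0.le, Finset.prod_const, Finset.card_univ]
    rw [← Real.rpow_mul_natCast (by linarith)]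
    congr 2
    ring
  rw [setLIntegral_congr_fun measurableSet_Ioi hin, lintegral_rpow_one_add_two_mul (by linarith)]
  congr 2
  ring

end InverseMoment

/-! ### Gaussian quaternion matrices and their rotational invariance. -/

section GaussianMatrix

instance secondCountableTopologyQuaternion : SecondCountableTopology ℍ[ℝ] :=
  have : ProperSpace ℍ[ℝ] := FiniteDimensional.proper_real _
  inferInstance

instance borelSpaceQMatrix (m n : ℕ) : BorelSpace (QMatrix m n) :=
  inferInstanceAs (BorelSpace (Fin m → Fin n → ℍ[ℝ]))

instance secondCountableTopologyQMatrix (m n : ℕ) : SecondCountableTopology (QMatrix m n) :=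
  inferInstanceAs (SecondCountableTopology (Fin m → Fin n → ℍ[ℝ]))

/-- The quaternion matrix with prescribed real components. -/
def ofComponents {m n : ℕ} (x : (Fin m × Fin n) × Fin 4 → ℝ) : QMatrix m n :=
  Matrix.of fun i j => ⟨x ((i, j), 0), x ((i, j), 1), x ((i, j), 2), x ((i, j), 3)⟩

theorem component_ofComponents {m n : ℕ} (x : (Fin m × Fin n) × Fin 4 → ℝ)
    (p : (Fin m × Fin n) × Fin 4) : component p.2 (ofComponents x p.1.1 p.1.2) = x p := by
  obtain ⟨⟨i, j⟩, k⟩ := p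
  fin_cases k <;> rfl

theorem continuous_ofComponents {m n : ℕ} :
    Continuous (ofComponents : ((Fin m × Fin n) × Fin 4 → ℝ) → QMatrix m n) := by
  refine continuous_matrix fun i j => ?_
  let L : ((Fin m × Fin n) × Fin 4 → ℝ) →ₗ[ℝ] ℍ[ℝ] :=
    { toFun := fun x => ofComponents x i j
      map_add' := fun x y => rfl
      map_smul' := fun c x => rfl }
  exact L.continuous_of_finiteDimensional

/-- The law of a standard Gaussian quaternion matrix. -/
noncomputable def gaussMat (m n : ℕ) : Measure (QMatrix m n) :=
  (Measure.pi fun _ : (Fin m × Fin n) × Fin 4 => gaussianReal 0 1).map ofComponents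

instance isProbabilityMeasureGaussMat (m n : ℕ) : IsProbabilityMeasure (gaussMat m n) :=
  Measure.isProbabilityMeasure_map continuous_ofComponents.measurable.aemeasurable

theorem continuous_component (k : Fin 4) : Continuous (component k) := by
  fin_cases k
  exacts [Quaternion.continuous_re, Quaternion.continuous_imI, Quaternion.continuous_imJ,
    Quaternion.continuous_imK]

theorem measurable_entry {m n : ℕ} (i : Fin m) (j : Fin n) :
    Measurable fun A : QMatrix m n => A i j :=
  (continuous_id.matrix_elem i j).measurable

theorem IsStdGaussian.map_eq {Ω : Type*} [MeasurableSpace Ω] {μ : Measure Ω}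
    [IsProbabilityMeasure μ] {m n : ℕ} {G : Ω → QMatrix m n} (h : IsStdGaussian μ G) :
    μ.map G = gaussMat m n := by
  have hm : ∀ p : (Fin m × Fin n) × Fin 4,
      Measurable fun ω => component p.2 (G ω p.1.1 p.1.2) := fun p =>
    (continuous_component p.2).measurable.comp ((measurable_entry _ _).comp h.measurable)
  have h1 := (iIndepFun_iff_map_fun_eq_pi_map fun p => (hm p).aemeasurable).1 h.indep
  simp only [h.law] at h1
  rw [gaussMat, ← h1, Measure.map_map continuous_ofComponents.measurable (measurable_pi_lambda _ hm)]
  rfl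

theorem frobInner_eq_sum_component {m n : ℕ} (A B : QMatrix m n) :
    frobInner A B = ∑ p : (Fin m × Fin n) × Fin 4,
      component p.2 (A p.1.1 p.1.2) * component p.2 (B p.1.1 p.1.2) := by
  rw [frobInner_eq_sum, Fintype.sum_prod_type, Fintype.sum_prod_type]
  refine Finset.sum_congr rfl fun i _ => Finset.sum_congr rfl fun j _ => ?_
  simp only [Fin.sum_univ_four, component, Quaternion.re_mul, Quaternion.re_star,
    Quaternion.imI_star, Quaternion.imJ_star, Quaternion.imK_star, Matrix.cons_val]
  ring

theorem frobSq_eq_sum_component {m n : ℕ} (A : QMatrix m n) :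
    frobSq A = ∑ p : (Fin m × Fin n) × Fin 4, component p.2 (A p.1.1 p.1.2) ^ 2 := by
  rw [frobSq, frobInner_eq_sum_component]
  exact Finset.sum_congr rfl fun p _ => (sq _).symm

theorem continuous_frobInner {β : Type*} [TopologicalSpace β] {m n : ℕ} {f g : β → QMatrix m n}
    (hf : ∀ i j, Continuous fun b => f b i j) (hg : ∀ i j, Continuous fun b => g b i j) :
    Continuous fun b => frobInner (f b) (g b) := by
  simp only [frobInner_eq_sum_component]
  exact continuous_finsetSum _ fun p _ => ((continuous_component p.2).comp (hf p.1.1 p.1.2)).mul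
    ((continuous_component p.2).comp (hg p.1.1 p.1.2))

theorem continuous_frobInner_left {m n : ℕ} (T : QMatrix m n) :
    Continuous fun X => frobInner T X :=
  continuous_frobInner (fun _ _ => continuous_const) fun i j => continuous_id.matrix_elem i j

theorem continuous_frobSq {m n : ℕ} : Continuous fun A : QMatrix m n => frobSq A :=
  continuous_frobInner (fun i j => continuous_id.matrix_elem i j)
    fun i j => continuous_id.matrix_elem i j

/-- The characteristic function is a product over real components and depends on `T` only through
its Frobenius norm; the invariance properties below all rest on this. -/
theorem integral_cexp_gaussMat {m n : ℕ} (T : QMatrix m n) :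
    ∫ X, Complex.exp (frobInner T X * Complex.I) ∂gaussMat m n = Complex.exp (-frobSq T / 2) := by
  have hc : Continuous fun X : QMatrix m n => Complex.exp (frobInner T X * Complex.I) := by
    have := continuous_frobInner_left T
    fun_prop
  rw [gaussMat, integral_map continuous_ofComponents.measurable.aemeasurable
    hc.aestronglyMeasurable]
  have e : ∀ x : (Fin m × Fin n) × Fin 4 → ℝ,
      Complex.exp (frobInner T (ofComponents x) * Complex.I) =
        ∏ p, Complex.exp ((component p.2 (T p.1.1 p.1.2) : ℝ) * (x p : ℝ) * Complex.I) := by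
    intro x
    rw [← Complex.exp_sum, frobInner_eq_sum_component, ← Finset.sum_mul]
    congr 2
    push_cast
    exact Finset.sum_congr rfl fun p _ => by rw [component_ofComponents]
  simp only [e]
  rw [integral_fintype_prod_eq_prod (fun (p : (Fin m × Fin n) × Fin 4) (x : ℝ) =>
    Complex.exp ((component p.2 (T p.1.1 p.1.2) : ℝ) * (x : ℝ) * Complex.I))]
  simp only [← charFun_apply_real, charFun_gaussianReal]
  rw [← Complex.exp_sum, frobSq_eq_sum_component]
  congr 1
  push_cast
  rw [neg_div, Finset.sum_div, ← Finset.sum_neg_distrib]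
  exact Finset.sum_congr rfl fun p _ => by simp

/-- Finite measures on pairs of quaternion matrices are determined by their Fourier transforms. -/
theorem ext_of_integral_cexp_frobInner {a b c d : ℕ}
    {P P' : Measure (QMatrix a b × QMatrix c d)} [IsFiniteMeasure P] [IsFiniteMeasure P']
    (h : ∀ S T, ∫ Z, Complex.exp ((frobInner S Z.1 + frobInner T Z.2 : ℝ) * Complex.I) ∂P =
      ∫ Z, Complex.exp ((frobInner S Z.1 + frobInner T Z.2 : ℝ) * Complex.I) ∂P') : P = P' := by
  let L : ((Fin a → Fin b → ℍ[ℝ]) × (Fin c → Fin d → ℍ[ℝ])) →ₗ[ℝ]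
      (QMatrix a b × QMatrix c d) →ₗ[ℝ] ℝ :=
    LinearMap.mk₂ ℝ (fun v w => frobInner w.1 (Matrix.of v.1) + frobInner w.2 (Matrix.of v.2))
      (fun v v' w => by
        simp only [Prod.fst_add, Prod.snd_add, ← Matrix.of_add_of, frobInner_add_right]; ring)
      (fun r v w => by
        simp only [Prod.smul_fst, Prod.smul_snd, ← Matrix.smul_of, frobInner_smul_right,
          smul_eq_mul]; ring)
      (fun v w w' => by
        simp only [Prod.fst_add, Prod.snd_add, frobInner_add_left]; ring)
      (fun r v w => by
        simp only [Prod.smul_fst, Prod.smul_snd, frobInner_comm (r • _), frobInner_smul_right,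
          smul_eq_mul, frobInner_comm w.1, frobInner_comm w.2]; ring)
  have hL : Continuous fun p : ((Fin a → Fin b → ℍ[ℝ]) × (Fin c → Fin d → ℍ[ℝ])) ×
      (QMatrix a b × QMatrix c d) => L p.1 p.2 := by
    refine Continuous.add ?_ ?_
    · exact continuous_frobInner
        (fun i j => (continuous_fst.comp continuous_snd).matrix_elem i j)
        fun i j => (continuous_apply_apply i j).comp (continuous_fst.comp continuous_fst)
    · exact continuous_frobInner
        (fun i j => (continuous_snd.comp continuous_snd).matrix_elem i j)
        fun i j => (continuous_apply_apply i j).comp (continuous_snd.comp continuous_fst)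
  -- The pairing separates points: a vector paired with itself gives its squared norm.
  have hL' : ∀ v, v ≠ 0 → L v ≠ 0 := by
    rintro ⟨x, y⟩ hv h0
    have h1 : frobSq (Matrix.of x) + frobSq (Matrix.of y) = 0 :=
      LinearMap.congr_fun h0 (Matrix.of x, Matrix.of y)
    have h2 := frobSq_nonneg (Matrix.of x)
    have h3 := frobSq_nonneg (Matrix.of y)
    apply hv
    have h4 : Matrix.of x = 0 := frobSq_eq_zero.1 (by linarith)
    have h5 : Matrix.of y = 0 := frobSq_eq_zero.1 (by linarith)
    exact Prod.ext h4 h5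
  let R : Measure ((Fin a → Fin b → ℍ[ℝ]) × (Fin c → Fin d → ℍ[ℝ])) := P
  let R' : Measure ((Fin a → Fin b → ℍ[ℝ]) × (Fin c → Fin d → ℍ[ℝ])) := P'
  have hR : IsFiniteMeasure R := ‹IsFiniteMeasure P›
  have hR' : IsFiniteMeasure R' := ‹IsFiniteMeasure P'›
  have key : R = R' := ext_of_integral_char_eq Real.continuous_probChar Real.probChar_ne_one hL' hL
    fun w => h w.1 w.2
  exact key

/-- The uniqueness statement for pairs is reused by adjoining a constant matrix of size zero. -/
theorem gaussMat_unique {m n : ℕ} {P : Measure (QMatrix m n)} [IsFiniteMeasure P]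
    (h : ∀ T, ∫ X, Complex.exp (frobInner T X * Complex.I) ∂P = Complex.exp (-frobSq T / 2)) :
    P = gaussMat m n := by
  have hm : Measurable fun X : QMatrix m n => (X, (0 : QMatrix 0 0)) :=
    measurable_id.prodMk measurable_const
  have hc : ∀ S (T : QMatrix 0 0), Continuous fun Z : QMatrix m n × QMatrix 0 0 =>
      Complex.exp ((frobInner S Z.1 + frobInner T Z.2 : ℝ) * Complex.I) := by
    intro S T
    have h1 := (continuous_frobInner_left S).comp (continuous_fst (Y := QMatrix 0 0))
    have h2 := (continuous_frobInner_left T).comp (continuous_snd (X := QMatrix m n))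
    simp only [Function.comp_def] at h1 h2
    fun_prop
  have key : P.map (fun X => (X, (0 : QMatrix 0 0))) =
      (gaussMat m n).map fun X => (X, (0 : QMatrix 0 0)) := by
    refine ext_of_integral_cexp_frobInner fun S T => ?_
    rw [integral_map hm.aemeasurable (hc S T).aestronglyMeasurable,
      integral_map hm.aemeasurable (hc S T).aestronglyMeasurable]
    simp only [frobInner_zero_right, add_zero, h, integral_cexp_gaussMat]
  have := congrArg (Measure.map Prod.fst) key
  rw [Measure.map_map measurable_fst hm, Measure.map_map measurable_fst hm] at this
  simpa only [Function.comp_def, Measure.map_id'] using this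

theorem continuous_mul_pair {a b c d : ℕ} (Q : QMatrix b c) (B : QMatrix b d) :
    Continuous fun X : QMatrix a b => (X * Q, X * B) :=
  (continuous_id.matrix_mul continuous_const).prodMk (continuous_id.matrix_mul continuous_const)

/-- Rotational invariance: the products of a Gaussian matrix with an isometry and with a matrix
orthogonal to it are independent, and the former is Gaussian. -/
theorem gaussMat_map_mul_pair {l m s k : ℕ} {Q : QMatrix m s} (hQ : Qᴴ * Q = 1)
    {B : QMatrix m k} (hB : Qᴴ * B = 0) :
    (gaussMat l m).map (fun X => (X * Q, X * B)) =
      (gaussMat l s).prod ((gaussMat l m).map fun X => X * B) := by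
  have hc2 : Continuous fun X : QMatrix l m => X * B := continuous_id.matrix_mul continuous_const
  have : IsProbabilityMeasure ((gaussMat l m).map fun X => X * B) :=
    Measure.isProbabilityMeasure_map hc2.measurable.aemeasurable
  refine ext_of_integral_cexp_frobInner fun S T => ?_
  have h1 := continuous_frobInner_left S
  have h2 := continuous_frobInner_left T
  have hc : Continuous fun Z : QMatrix l s × QMatrix l k =>
      Complex.exp ((frobInner S Z.1 + frobInner T Z.2 : ℝ) * Complex.I) := by
    fun_prop
  rw [integral_map (continuous_mul_pair Q B).measurable.aemeasurable hc.aestronglyMeasurable]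
  have e1 : ∀ X : QMatrix l m, frobInner S (X * Q) + frobInner T (X * B) =
      frobInner (S * Qᴴ + T * Bᴴ) X := by
    intro X
    rw [frobInner_add_left, frobInner_mul_right, frobInner_mul_right,
      Matrix.conjTranspose_conjTranspose, Matrix.conjTranspose_conjTranspose]
  -- Orthogonality `Qᴴ * B = 0` kills the cross term, so the joint characteristic function factors,
  -- which is independence.
  have e2 : frobSq (S * Qᴴ + T * Bᴴ) = frobSq S + frobSq (T * Bᴴ) := by
    rw [frobSq_add_of_orthogonal, frobSq_mul_coisometry hQ]
    rw [frobInner_comm, frobInner_mul_right, Matrix.conjTranspose_conjTranspose, Matrix.mul_assoc,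
      hB, Matrix.mul_zero, frobInner_zero_right]
  have e3 : ∀ Z : QMatrix l s × QMatrix l k,
      Complex.exp ((frobInner S Z.1 + frobInner T Z.2 : ℝ) * Complex.I) =
        Complex.exp (frobInner S Z.1 * Complex.I) * Complex.exp (frobInner T Z.2 * Complex.I) := by
    intro Z
    rw [← Complex.exp_add, Complex.ofReal_add, add_mul]
  simp only [e1, integral_cexp_gaussMat, e2]
  simp only [e3]
  rw [integral_prod_mul (fun X => Complex.exp (frobInner S X * Complex.I))
    (fun Y => Complex.exp (frobInner T Y * Complex.I)), integral_cexp_gaussMat,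
    integral_map hc2.measurable.aemeasurable (Continuous.aestronglyMeasurable (by fun_prop))]
  have e4 : ∀ X : QMatrix l m, frobInner T (X * B) = frobInner (T * Bᴴ) X := by
    intro X
    rw [frobInner_mul_right, Matrix.conjTranspose_conjTranspose]
  simp only [e4, integral_cexp_gaussMat]
  rw [← Complex.exp_add]
  congr 1
  push_cast
  ring

/-- The multiplication passes across the pairing to the test matrix `T`, where it preserves the
norm. -/
theorem gaussMat_map_mul {l m s : ℕ} {Q : QMatrix m s} (hQ : Qᴴ * Q = 1) :
    (gaussMat l m).map (fun X => X * Q) = gaussMat l s := by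
  have hc : Continuous fun X : QMatrix l m => X * Q := continuous_id.matrix_mul continuous_const
  refine gaussMat_unique fun T => ?_
  have := continuous_frobInner_left T
  rw [integral_map hc.measurable.aemeasurable (Continuous.aestronglyMeasurable (by fun_prop))]
  simp only [fun X : QMatrix l m => show frobInner T (X * Q) = frobInner (T * Qᴴ) X by
    rw [frobInner_mul_right, Matrix.conjTranspose_conjTranspose], integral_cexp_gaussMat,
    frobSq_mul_coisometry hQ]

theorem gaussMat_map_conjTranspose_mul {l m s : ℕ} {Q : QMatrix l s} (hQ : Qᴴ * Q = 1) :
    (gaussMat l m).map (fun X => Qᴴ * X) = gaussMat s m := by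
  have hc : Continuous fun X : QMatrix l m => Qᴴ * X := continuous_const.matrix_mul continuous_id
  refine gaussMat_unique fun T => ?_
  have := continuous_frobInner_left T
  rw [integral_map hc.measurable.aemeasurable (Continuous.aestronglyMeasurable (by fun_prop))]
  simp only [← frobInner_mul_left, integral_cexp_gaussMat, frobSq_isometry_mul hQ]

theorem gaussMat_map_conjTranspose (l m : ℕ) :
    (gaussMat l m).map (fun X => Xᴴ) = gaussMat m l := by
  have hc : Continuous fun X : QMatrix l m => Xᴴ := continuous_id.matrix_conjTranspose
  refine gaussMat_unique fun T => ?_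
  have := continuous_frobInner_left T
  rw [integral_map hc.measurable.aemeasurable (Continuous.aestronglyMeasurable (by fun_prop))]
  have e : ∀ X : QMatrix l m, frobInner T Xᴴ = frobInner Tᴴ X := fun X => by
    rw [← frobInner_conjTranspose, Matrix.conjTranspose_conjTranspose]
  simp only [e, integral_cexp_gaussMat, frobSq_conjTranspose]

/-- A quaternion column of length `d` has `4 d` real coordinates, more than two as soon as `d ≥ 1`.
Hence the bounds stay finite even for `l = s`. -/
theorem lintegral_inv_frobSq_gaussMat {d : ℕ} (hd : 0 < d) :
    ∫⁻ u, (ENNReal.ofReal (frobSq u))⁻¹ ∂gaussMat d 1 =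
      ENNReal.ofReal (1 / (4 * (d : ℝ) - 2)) := by
  have hm : Measurable fun u : QMatrix d 1 => (ENNReal.ofReal (frobSq u))⁻¹ :=
    continuous_frobSq.measurable.ennreal_ofReal.inv
  rw [gaussMat, lintegral_map hm continuous_ofComponents.measurable]
  simp only [frobSq_eq_sum_component, component_ofComponents]
  have hcard : Fintype.card ((Fin d × Fin 1) × Fin 4) = d * 4 := by simp
  rw [lintegral_inv_sum_sq_pi_gaussianReal (by rw [hcard]; omega), hcard]
  congr 3
  push_cast
  ring

/-- By its characteristic function, `frobInner T X` is a centred real Gaussian with variance `frobSq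
T`. -/
theorem lintegral_frobInner_sq_gaussMat {m n : ℕ} (T : QMatrix m n) :
    ∫⁻ X, ENNReal.ofReal (frobInner T X ^ 2) ∂gaussMat m n = ENNReal.ofReal (frobSq T) := by
  have hT := continuous_frobInner_left T
  set v : NNReal := (frobSq T).toNNReal with hv
  have hvT : (v : ℝ) = frobSq T := Real.coe_toNNReal _ (frobSq_nonneg T)
  have hmap : (gaussMat m n).map (frobInner T) = gaussianReal 0 v := by
    have := Measure.isProbabilityMeasure_map (μ := gaussMat m n) hT.measurable.aemeasurable
    refine Measure.ext_of_charFun ?_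
    ext t
    rw [charFun_gaussianReal, charFun_apply_real, integral_map hT.measurable.aemeasurable
      (Continuous.aestronglyMeasurable (by fun_prop))]
    have e : ∀ X : QMatrix m n, ((t : ℂ) * (frobInner T X : ℝ)) =
        ((frobInner (t • T) X : ℝ) : ℂ) := fun X => by
      rw [frobInner_comm (t • T), frobInner_smul_right, frobInner_comm X]
      push_cast
      rfl
    simp only [e, integral_cexp_gaussMat]
    congr 1
    have : frobSq (t • T) = t ^ 2 * frobSq T := by
      rw [frobSq, frobInner_smul_right, frobInner_comm, frobInner_smul_right, frobSq]
      ring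
    rw [this, ← hvT]
    push_cast
    ring
  have hsq : Measurable fun x : ℝ => ENNReal.ofReal (x ^ 2) := by fun_prop
  rw [← lintegral_map hsq hT.measurable, hmap]
  have hL := memLp_id_gaussianReal (μ := 0) (v := v) 2
  rw [← ofReal_integral_eq_lintegral_ofReal (f := fun x : ℝ => x ^ 2)
    hL.integrable_sq
    (Filter.Eventually.of_forall fun _ => sq_nonneg _)]
  have := variance_eq_integral (μ := gaussianReal 0 v) (X := fun x => x) measurable_id.aemeasurable
  rw [variance_fun_id_gaussianReal] at this
  simp only [integral_id_gaussianReal, sub_zero] at this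
  rw [← this, hvT]

end GaussianMatrix

/-! ### Rank and inverse moments of tall Gaussian matrices. -/

section InverseGram

/-- Units are open in a complete normed ring; the operator norm is installed only locally and
induces the entrywise topology. Together with continuity of inversion on units, this makes `leftInv`
measurable. -/
theorem isOpen_setOf_isUnit_qMatrix (n : ℕ) : IsOpen {M : QMatrix n n | IsUnit M} := by
  let i1 : NormedRing (Matrix (Fin n) (Fin n) ℍ[ℝ]) := Matrix.linftyOpNormedRing
  have i2 : @CompleteSpace (Matrix (Fin n) (Fin n) ℍ[ℝ]) i1.toMetricSpace.toUniformSpace :=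
    inferInstanceAs (CompleteSpace (Fin n → Fin n → ℍ[ℝ]))
  have i3 : HasSummableGeomSeries (Matrix (Fin n) (Fin n) ℍ[ℝ]) := inferInstance
  exact Units.isOpen (R := Matrix (Fin n) (Fin n) ℍ[ℝ])

theorem continuousOn_inverse_qMatrix (n : ℕ) :
    ContinuousOn (Ring.inverse : QMatrix n n → QMatrix n n) {M : QMatrix n n | IsUnit M} := by
  let i1 : NormedRing (Matrix (Fin n) (Fin n) ℍ[ℝ]) := Matrix.linftyOpNormedRing
  have i2 : @CompleteSpace (Matrix (Fin n) (Fin n) ℍ[ℝ]) i1.toMetricSpace.toUniformSpace :=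
    inferInstanceAs (CompleteSpace (Fin n → Fin n → ℍ[ℝ]))
  have i3 : HasSummableGeomSeries (Matrix (Fin n) (Fin n) ℍ[ℝ]) := inferInstance
  rintro _ ⟨u, rfl⟩
  exact (NormedRing.inverse_continuousAt (R := Matrix (Fin n) (Fin n) ℍ[ℝ]) u).continuousWithinAt

theorem measurable_inverse_qMatrix (n : ℕ) :
    Measurable (Ring.inverse : QMatrix n n → QMatrix n n) := by
  classical
  -- `Ring.inverse` is continuous on the open set of units and has the default value zero elsewhere.
  have h := (continuousOn_inverse_qMatrix n).measurable_piecewise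
    (g := fun _ => (0 : QMatrix n n)) continuousOn_const
    (isOpen_setOf_isUnit_qMatrix n).measurableSet
  convert h using 1
  ext1 M
  by_cases hM : IsUnit M
  · exact (Set.piecewise_eq_of_mem {M : QMatrix n n | IsUnit M} _ _ hM).symm
  · rw [Ring.inverse_non_unit _ hM]
    exact (Set.piecewise_eq_of_notMem {M : QMatrix n n | IsUnit M} Ring.inverse
      (fun _ => (0 : QMatrix n n)) hM).symm

theorem continuous_gram (m n : ℕ) : Continuous fun M : QMatrix m n => Mᴴ * M :=
  continuous_id.matrix_conjTranspose.matrix_mul continuous_id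

theorem measurableSet_isUnit_gram (m n : ℕ) :
    MeasurableSet {M : QMatrix m n | IsUnit (Mᴴ * M)} :=
  ((isOpen_setOf_isUnit_qMatrix n).preimage (continuous_gram m n)).measurableSet

theorem measurable_qMatrix_mul {β : Type*} [MeasurableSpace β] {m n k : ℕ}
    {f : β → QMatrix m n} {g : β → QMatrix n k} (hf : Measurable f) (hg : Measurable g) :
    Measurable fun b => f b * g b := by
  have h : Continuous fun p : QMatrix m n × QMatrix n k => p.1 * p.2 :=
    continuous_fst.matrix_mul continuous_snd
  have h2 := h.measurable
  have h3 := hf.prodMk hg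
  have h4 := h2.comp h3
  exact h4

theorem measurable_leftInv (m n : ℕ) : Measurable (leftInv : QMatrix m n → QMatrix n m) :=
  measurable_qMatrix_mul ((measurable_inverse_qMatrix n).comp (continuous_gram m n).measurable)
    continuous_id.matrix_conjTranspose.measurable

theorem leftInv_of_not_isUnit {m n : ℕ} {M : QMatrix m n} (h : ¬IsUnit (Mᴴ * M)) :
    leftInv M = 0 := by
  rw [leftInv, Ring.inverse_non_unit _ h, Matrix.zero_mul]

/-- The `j`-th coordinate vector, as a matrix with one column. -/
noncomputable def unitCol {n : ℕ} (j : Fin n) : QMatrix n 1 := Matrix.of fun i _ => if i = j then 1 else 0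

theorem mul_unitCol_apply {m n : ℕ} (M : QMatrix m n) (j : Fin n) (i : Fin m) (k : Fin 1) :
    (M * unitCol j) i k = M i j := by
  simp [Matrix.mul_apply, unitCol]

theorem unitCol_isometry {n : ℕ} (j : Fin n) : (unitCol j)ᴴ * unitCol j = 1 := by
  ext1 i k
  rw [mul_unitCol_apply, Matrix.conjTranspose_apply, Subsingleton.elim i k]
  simp [unitCol]

theorem unitCol_conjTranspose_mul_apply {m n : ℕ} (M : QMatrix n m) (j : Fin n) (k : Fin 1)
    (i : Fin m) : ((unitCol j)ᴴ * M) k i = M j i := by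
  simp [Matrix.mul_apply, unitCol, apply_ite star]

theorem unitCol_conjTranspose_mulVec {n : ℕ} (x : Fin n → ℍ[ℝ]) (j : Fin n) (k : Fin 1) :
    ((unitCol j)ᴴ *ᵥ x) k = x j := by
  simp [Matrix.mulVec, dotProduct, unitCol, apply_ite star]

theorem frobSq_eq_sum_unitCol {m n : ℕ} (M : QMatrix m n) :
    frobSq M = ∑ i, frobSq ((unitCol i)ᴴ * M) := by
  rw [frobSq_eq_sum]
  refine Finset.sum_congr rfl fun i _ => ?_
  rw [frobSq_eq_sum, Fintype.sum_subsingleton _ (0 : Fin 1)]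
  exact Finset.sum_congr rfl fun j _ =>
    (congrArg Quaternion.normSq (unitCol_conjTranspose_mul_apply M i 0 j)).symm

/-- Right multiplication by an orthogonal projection is a contraction. -/
theorem frobSq_mul_proj_le {m n : ℕ} {P : QMatrix n n} (hP : Pᴴ = P) (hP2 : P * P = P)
    (w : QMatrix m n) : frobSq (w * P) ≤ frobSq w := by
  have h : frobInner (w * P) (w - w * P) = 0 := by
    rw [frobInner_mul_right, hP, Matrix.sub_mul, Matrix.mul_assoc, hP2, sub_self,
      frobInner_zero_right]
  have h2 := frobSq_add_of_orthogonal h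
  rw [add_sub_cancel] at h2
  linarith [frobSq_nonneg (w - w * P)]

theorem conjTranspose_mul_self_col {d : ℕ} (u : QMatrix d 1) :
    uᴴ * u = frobSq u • (1 : QMatrix 1 1) := by
  ext1 i j
  rw [Subsingleton.elim j i, Matrix.mul_apply, Matrix.smul_apply, Matrix.one_apply_eq]
  have h : vecSq (fun a => u a i) = frobSq u := by
    rw [frobSq_eq_sum_vecSq, Fintype.sum_subsingleton _ i]
  rw [← h, ← Quaternion.coe_mul_eq_smul, mul_one, ← sum_star_mul_self]
  rfl

/-- Expressing a row of the left inverse by the component of a column orthogonal to the others. -/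
theorem exists_isometry_row_bound {l s d : ℕ} (hd : s + d ≤ l + 1) (j : Fin s) {C : QMatrix l s}
    (hC : C * unitCol j = 0) : ∃ Q : QMatrix l d, Qᴴ * Q = 1 ∧ ∀ c : QMatrix l 1,
      (frobSq (Qᴴ * c) ≠ 0 → ∀ x, (C + c * (unitCol j)ᴴ) *ᵥ x = 0 → x j = 0) ∧
      ENNReal.ofReal (frobSq ((unitCol j)ᴴ * leftInv (C + c * (unitCol j)ᴴ))) ≤
        (ENNReal.ofReal (frobSq (Qᴴ * c)))⁻¹ := by
  -- With the identity as `H` this is an orthonormal system orthogonal to the `s - 1` columns of `C`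
  -- other than the `j`-th, which is zero.
  obtain ⟨Q, hQ, hQC⟩ := exists_orthonormal_image (H := (1 : QMatrix l l))
    (fun x hx => by rwa [Matrix.one_mulVec] at hx) (C.submatrix id ((↑) : {k // k ≠ j} → Fin s)) d
    (by have := j.2; simp; omega)
  rw [Matrix.one_mul] at hQ
  have hQC' : Qᴴ * C = 0 := by
    ext1 a k
    by_cases hk : k = j
    · subst hk
      rw [Matrix.mul_apply]
      refine Finset.sum_eq_zero fun b _ => ?_
      have : C b k = 0 := by
        rw [← mul_unitCol_apply C k b 0, hC]
        rfl
      rw [this, mul_zero]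
    · have := congrArg star (congrFun (congrFun hQC ⟨k, hk⟩) a)
      rw [Matrix.mul_apply, star_sum] at this
      rw [Matrix.mul_apply]
      simpa using this
  refine ⟨Q, hQ, fun c => ?_⟩
  set u := Qᴴ * c with hu
  set M := C + c * (unitCol j)ᴴ with hM
  -- If `u = 0`, the first claim is empty and the right side of the second is infinite.
  by_cases hS : frobSq u = 0
  · simp [hS]
  have hSpos : 0 < frobSq u := (frobSq_nonneg u).lt_of_ne (Ne.symm hS)
  -- This row annihilates `C` and is normalized against `c`, so `w * M` is the `j`-th unit row, with
  -- squared length `1 / frobSq u`.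
  set w : QMatrix 1 l := (frobSq u)⁻¹ • (uᴴ * Qᴴ) with hw
  have hwM : w * M = (unitCol j)ᴴ := by
    have h1 : uᴴ * Qᴴ * M = frobSq u • (unitCol j)ᴴ := by
      rw [Matrix.mul_assoc, hM, Matrix.mul_add, hQC', zero_add, ← Matrix.mul_assoc Qᴴ, ← hu,
        ← Matrix.mul_assoc, conjTranspose_mul_self_col, Matrix.smul_mul, Matrix.one_mul]
    rw [hw, Matrix.smul_mul, h1, smul_smul, inv_mul_cancel₀ hS, one_smul]
  have hwS : frobSq w = (frobSq u)⁻¹ := by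
    have h1 : frobSq (uᴴ * Qᴴ) = frobSq u := by
      rw [frobSq_mul_coisometry hQ, frobSq_conjTranspose]
    rw [hw, frobSq, frobInner_smul_right, frobInner_comm, frobInner_smul_right]
    change _ * (_ * frobSq (uᴴ * Qᴴ)) = _
    rw [h1, inv_mul_cancel₀ hS, mul_one]
  refine ⟨fun _ x hx => ?_, ?_⟩
  · rw [← unitCol_conjTranspose_mulVec x j 0, ← hwM, ← Matrix.mulVec_mulVec, hx,
      Matrix.mulVec_zero]
    rfl
  · by_cases hU : IsUnit (Mᴴ * M)
    · have hP := isMoorePenrose_leftInv hU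
      -- The row of the left inverse equals `w * (M * leftInv M)`, the image of `w` under an
      -- orthogonal projection.
      have h1 : frobSq ((unitCol j)ᴴ * leftInv M) ≤ (frobSq u)⁻¹ := by
        rw [← hwM, Matrix.mul_assoc, ← hwS]
        refine frobSq_mul_proj_le hP.left_hermitian ?_ w
        rw [← Matrix.mul_assoc, hP.mul_mul_self]
      rw [← ENNReal.ofReal_inv_of_pos hSpos]
      exact ENNReal.ofReal_le_ofReal h1
    · rw [leftInv_of_not_isUnit hU, Matrix.mul_zero]
      simp [frobSq, frobInner]

theorem lintegral_inv_frobSq_isometry {l d : ℕ} (hd : 0 < d) {Q : QMatrix l d} (hQ : Qᴴ * Q = 1) :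
    ∫⁻ c, (ENNReal.ofReal (frobSq (Qᴴ * c)))⁻¹ ∂gaussMat l 1 =
      ENNReal.ofReal (1 / (4 * (d : ℝ) - 2)) := by
  have h1 : Measurable fun u : QMatrix d 1 => (ENNReal.ofReal (frobSq u))⁻¹ :=
    continuous_frobSq.measurable.ennreal_ofReal.inv
  have h2 : Measurable fun c : QMatrix l 1 => Qᴴ * c :=
    (continuous_const.matrix_mul continuous_id).measurable
  rw [← lintegral_inv_frobSq_gaussMat hd, ← gaussMat_map_conjTranspose_mul hQ, lintegral_map h1 h2]

/-- A finite mean of the inverse forces the inverse to be finite almost surely. -/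
theorem ae_frobSq_isometry_ne_zero {l d : ℕ} (hd : 0 < d) {Q : QMatrix l d} (hQ : Qᴴ * Q = 1) :
    ∀ᵐ c ∂gaussMat l 1, frobSq (Qᴴ * c) ≠ 0 := by
  have hm : Measurable fun c : QMatrix l 1 => (ENNReal.ofReal (frobSq (Qᴴ * c)))⁻¹ :=
    (continuous_frobSq.comp
      (continuous_const.matrix_mul continuous_id)).measurable.ennreal_ofReal.inv
  filter_upwards [ae_lt_top hm (by rw [lintegral_inv_frobSq_isometry hd hQ]; simp)] with c hc h0
  simp [h0] at hc

/-- The inclusion of the first `s` of `s + 1` coordinates. -/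
noncomputable def initCols (s : ℕ) : QMatrix (s + 1) s := Matrix.of fun i j => if i = j.castSucc then 1 else 0

theorem initCols_isometry (s : ℕ) : (initCols s)ᴴ * initCols s = 1 := by
  ext1 i j
  simp [Matrix.mul_apply, initCols, Matrix.one_apply, eq_comm, apply_ite star]

theorem initCols_conjTranspose_mul_unitCol (s : ℕ) :
    (initCols s)ᴴ * unitCol (Fin.last s) = 0 := by
  ext1 i j
  rw [mul_unitCol_apply]
  simp [initCols, (Fin.castSucc_lt_last i).ne']

theorem initCols_add_unitCol (s : ℕ) :
    initCols s * (initCols s)ᴴ + unitCol (Fin.last s) * (unitCol (Fin.last s))ᴴ = 1 := by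
  ext1 i j
  simp only [Matrix.add_apply, Matrix.mul_apply, Matrix.conjTranspose_apply, initCols, unitCol,
    Matrix.of_apply]
  refine Fin.lastCases ?_ (fun i => ?_) i <;> refine Fin.lastCases ?_ (fun j => ?_) j <;>
    simp [Matrix.one_apply, eq_comm, (Fin.castSucc_lt_last _).ne, apply_ite star]

/-- A tall Gaussian matrix almost surely has full column rank. -/
theorem ae_isUnit_gram_gaussMat {l s : ℕ} (h : s ≤ l) :
    ∀ᵐ M ∂gaussMat l s, IsUnit (Mᴴ * M) := by
  induction s with
  | zero => exact Filter.Eventually.of_forall fun M => isUnit_of_subsingleton _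
  | succ s ih =>
    set E := initCols s with hE
    set e := unitCol (Fin.last s) with he
    -- The first `s` columns and the last one are independent Gaussian, so the last can be drawn
    -- with the others fixed.
    have hpair := gaussMat_map_mul_pair (l := l) (initCols_isometry s)
      (initCols_conjTranspose_mul_unitCol s)
    rw [gaussMat_map_mul (unitCol_isometry (Fin.last s))] at hpair
    have hcont : Continuous fun p : QMatrix l s × QMatrix l 1 => p.1 * Eᴴ + p.2 * eᴴ :=
      (continuous_fst.matrix_mul continuous_const).add (continuous_snd.matrix_mul continuous_const)
    have hms : MeasurableSet {p : QMatrix l s × QMatrix l 1 |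
        IsUnit ((p.1 * Eᴴ + p.2 * eᴴ)ᴴ * (p.1 * Eᴴ + p.2 * eᴴ))} :=
      hcont.measurable (measurableSet_isUnit_gram l (s + 1))
    have hprod : ∀ᵐ p ∂(gaussMat l s).prod (gaussMat l 1),
        IsUnit ((p.1 * Eᴴ + p.2 * eᴴ)ᴴ * (p.1 * Eᴴ + p.2 * eᴴ)) := by
      rw [Measure.ae_prod_iff_ae_ae hms]
      filter_upwards [ih (by omega)] with C hC
      have hCe : C * Eᴴ * e = 0 := by
        rw [Matrix.mul_assoc, hE, he, initCols_conjTranspose_mul_unitCol, Matrix.mul_zero]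
      obtain ⟨Q, hQ, hQc⟩ := exists_isometry_row_bound (d := 1) (by omega) (Fin.last s) hCe
      filter_upwards [ae_frobSq_isometry_ne_zero one_pos hQ] with c hc
      refine FullColumnRank.isUnit_gram fun x hx => ?_
      -- The last column has a component orthogonal to the others, so a kernel vector has last
      -- coordinate zero; the induction hypothesis removes the remaining coordinates.
      have hlast := (hQc c).1 hc x hx
      have hex : eᴴ *ᵥ x = 0 := by
        ext1 k
        rw [he, unitCol_conjTranspose_mulVec, hlast]
        rfl
      have hEx : Eᴴ *ᵥ x = 0 := by
        refine FullColumnRank.of_isUnit_gram hC _ ?_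
        rw [Matrix.add_mulVec, ← Matrix.mulVec_mulVec, ← Matrix.mulVec_mulVec, hex,
          Matrix.mulVec_zero, add_zero] at hx
        exact hx
      rw [← Matrix.one_mulVec x, ← initCols_add_unitCol, Matrix.add_mulVec,
        ← Matrix.mulVec_mulVec, ← Matrix.mulVec_mulVec, ← hE, ← he, hEx, hex, Matrix.mulVec_zero,
        Matrix.mulVec_zero, add_zero]
    rw [← hpair] at hprod
    filter_upwards [ae_of_ae_map (continuous_mul_pair _ _).measurable.aemeasurable hprod] with M hM
    have : M * initCols s * Eᴴ + M * unitCol (Fin.last s) * eᴴ = M := by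
      rw [Matrix.mul_assoc, Matrix.mul_assoc, ← Matrix.mul_add, hE, he, initCols_add_unitCol,
        Matrix.mul_one]
    simpa only [this] using hM

/-- The expected squared norm of a row of the left inverse of a Gaussian matrix. -/
theorem lintegral_row_leftInv_le {l s : ℕ} (h : s ≤ l) (j : Fin s) :
    ∫⁻ M, ENNReal.ofReal (frobSq ((unitCol j)ᴴ * leftInv M)) ∂gaussMat l s ≤
      ENNReal.ofReal (1 / (4 * ((l : ℝ) - s) + 2)) := by
  set e := unitCol j with he
  -- Right multiplication by `B` replaces column `j` by zero; `eᴴ * B = 0` makes this matrix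
  -- independent of that column.
  set B : QMatrix s s := 1 - e * eᴴ with hB
  have heB : eᴴ * B = 0 := by
    rw [hB, Matrix.mul_sub, ← Matrix.mul_assoc, he, unitCol_isometry, Matrix.mul_one,
      Matrix.one_mul, sub_self]
  have hBe : B * e = 0 := by
    rw [hB, Matrix.sub_mul, Matrix.mul_assoc, he, unitCol_isometry, Matrix.mul_one,
      Matrix.one_mul, sub_self]
  have hpair := gaussMat_map_mul_pair (l := l) (unitCol_isometry j) heB
  rw [← he] at hpair
  have hBm : Measurable fun M : QMatrix l s => M * B :=
    (continuous_id.matrix_mul continuous_const).measurable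
  have hcont : Continuous fun p : QMatrix l 1 × QMatrix l s => p.2 + p.1 * eᴴ :=
    continuous_snd.add (continuous_fst.matrix_mul continuous_const)
  have hm : Measurable fun p : QMatrix l 1 × QMatrix l s =>
      ENNReal.ofReal (frobSq (eᴴ * leftInv (p.2 + p.1 * eᴴ))) :=
    (continuous_frobSq.measurable.comp (measurable_qMatrix_mul measurable_const
      ((measurable_leftInv l s).comp hcont.measurable))).ennreal_ofReal
  have hdec : ∀ M : QMatrix l s, M * B + M * e * eᴴ = M := by
    intro M
    rw [hB, Matrix.mul_sub, Matrix.mul_one, Matrix.mul_assoc, sub_add_cancel]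
  have hprob := Measure.isProbabilityMeasure_map (μ := gaussMat l s) hBm.aemeasurable
  calc ∫⁻ M, ENNReal.ofReal (frobSq (eᴴ * leftInv M)) ∂gaussMat l s
      = ∫⁻ p, ENNReal.ofReal (frobSq (eᴴ * leftInv (p.2 + p.1 * eᴴ)))
          ∂(gaussMat l 1).prod ((gaussMat l s).map fun M : QMatrix l s => M * B) := by
        rw [← hpair, lintegral_map hm (continuous_mul_pair e B).measurable]
        simp only [hdec]
    _ = ∫⁻ M, ∫⁻ c, ENNReal.ofReal (frobSq (eᴴ * leftInv (M * B + c * eᴴ))) ∂gaussMat l 1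
          ∂gaussMat l s := by
        rw [lintegral_prod_symm _ hm.aemeasurable, lintegral_map hm.lintegral_prod_left' hBm]
    _ ≤ ∫⁻ _, ENNReal.ofReal (1 / (4 * ((l : ℝ) - s) + 2)) ∂gaussMat l s := by
        refine lintegral_mono fun M => ?_
        -- The other `s - 1` columns leave `l + 1 - s` orthogonal directions, and `4 (l + 1 - s) - 2
        -- = 4 (l - s) + 2`.
        obtain ⟨Q, hQ, hQc⟩ := exists_isometry_row_bound (l := l) (d := l + 1 - s) (by omega) j
          (C := M * B) (by rw [Matrix.mul_assoc, hBe, Matrix.mul_zero])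
        refine (lintegral_mono fun c => (hQc c).2).trans_eq ?_
        rw [lintegral_inv_frobSq_isometry (by omega) hQ, Nat.cast_sub (by omega)]
        congr 2
        push_cast
        ring
    _ = ENNReal.ofReal (1 / (4 * ((l : ℝ) - s) + 2)) := by simp

/-- The expected squared Frobenius norm of the left inverse of a Gaussian matrix. -/
theorem lintegral_leftInv_le {l s : ℕ} (h : s ≤ l) :
    ∫⁻ M, ENNReal.ofReal (frobSq (leftInv M)) ∂gaussMat l s ≤
      ENNReal.ofReal (s / (4 * ((l : ℝ) - s) + 2)) := by
  have hpos : 0 < 4 * ((l : ℝ) - s) + 2 := by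
    have : (s : ℝ) ≤ l := by exact_mod_cast h
    linarith
  have e : ∀ M : QMatrix l s, ENNReal.ofReal (frobSq (leftInv M)) =
      ∑ j, ENNReal.ofReal (frobSq ((unitCol j)ᴴ * leftInv M)) := by
    intro M
    rw [frobSq_eq_sum_unitCol, ENNReal.ofReal_sum_of_nonneg fun _ _ => frobSq_nonneg _]
  simp only [e]
  rw [lintegral_finsetSum]
  · refine (Finset.sum_le_sum fun j _ => lintegral_row_leftInv_le h j).trans_eq ?_
    rw [Finset.sum_const, Finset.card_univ, Fintype.card_fin, ← ENNReal.ofReal_nsmul, nsmul_eq_mul,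
      mul_one_div]
  · intro j _
    exact (continuous_frobSq.measurable.comp (measurable_qMatrix_mul measurable_const
      (measurable_leftInv l s))).ennreal_ofReal

end InverseGram

/-! ### Mean square errors of the sketch and of the range finder. -/

section SketchError

/-- The standard real basis of the quaternions. -/
noncomputable def unitQuat (k : Fin 4) : ℍ[ℝ] := ![1, ⟨0, 1, 0, 0⟩, ⟨0, 0, 1, 0⟩, ⟨0, 0, 0, 1⟩] k

theorem normSq_unitQuat (k : Fin 4) : Quaternion.normSq (unitQuat k) = 1 := by
  rw [Quaternion.normSq_def']
  fin_cases k <;> simp [unitQuat]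

theorem re_star_unitQuat_mul (k : Fin 4) (q : ℍ[ℝ]) :
    (star (unitQuat k) * q).re = component k q := by
  rw [Quaternion.re_mul, Quaternion.re_star, Quaternion.imI_star, Quaternion.imJ_star,
    Quaternion.imK_star]
  fin_cases k <;> simp [unitQuat, component]

theorem frobInner_single {m n : ℕ} (i : Fin m) (j : Fin n) (q : ℍ[ℝ]) (Y : QMatrix m n) :
    frobInner (Matrix.single i j q) Y = (star q * Y i j).re := by
  rw [frobInner_eq_sum, Finset.sum_eq_single i, Finset.sum_eq_single j]
  · simp
  · intro b _ hb
    simp [hb.symm]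
  · simp
  · intro b _ hb
    refine Finset.sum_eq_zero fun c _ => ?_
    simp [hb.symm]
  · simp

/-- The entries are `star (K i a) * q * star (B b j)`, and the quaternion norm is multiplicative. -/
theorem frobSq_mul_single_mul {l m n p : ℕ} (K : QMatrix p l) (B : QMatrix m n) (i : Fin p)
    (j : Fin n) (q : ℍ[ℝ]) :
    frobSq (Kᴴ * Matrix.single i j q * Bᴴ) =
      (∑ a, Quaternion.normSq (K i a)) * Quaternion.normSq q *
        ∑ b, Quaternion.normSq (B b j) := by
  have e : ∀ a b, (Kᴴ * Matrix.single i j q * Bᴴ) a b = star (K i a) * q * star (B b j) := by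
    intro a b
    rw [Matrix.mul_apply, Finset.sum_eq_single j]
    · rw [Matrix.mul_single_apply_same, Matrix.conjTranspose_apply, Matrix.conjTranspose_apply]
    · intro c _ hc
      rw [Matrix.mul_single_apply_of_ne _ _ _ _ _ hc, zero_mul]
    · simp
  rw [frobSq_eq_sum, Finset.sum_mul, Finset.sum_mul]
  refine Finset.sum_congr rfl fun a _ => ?_
  rw [Finset.mul_sum]
  refine Finset.sum_congr rfl fun b _ => ?_
  exact (congrArg Quaternion.normSq (e a b)).trans
    (by rw [map_mul, map_mul, Quaternion.normSq_star, Quaternion.normSq_star])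

/-- The second moment of a Gaussian matrix multiplied from both sides. -/
theorem lintegral_frobSq_mul_mul_gaussMat {l m n p : ℕ} (K : QMatrix p l) (B : QMatrix m n) :
    ∫⁻ X, ENNReal.ofReal (frobSq (K * (X * B))) ∂gaussMat l m =
      ENNReal.ofReal (4 * frobSq K * frobSq B) := by
  -- Each real component of `K X B` is the pairing of `X` with a fixed matrix, so its second moment
  -- is known. Summing over the four quaternion units gives the factor `4`.
  have e : ∀ X : QMatrix l m, ENNReal.ofReal (frobSq (K * (X * B))) =
      ∑ t : (Fin p × Fin n) × Fin 4, ENNReal.ofReal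
        (frobInner (Kᴴ * Matrix.single t.1.1 t.1.2 (unitQuat t.2) * Bᴴ) X ^ 2) := by
    intro X
    rw [frobSq_eq_sum_component, ENNReal.ofReal_sum_of_nonneg fun _ _ => sq_nonneg _]
    refine Finset.sum_congr rfl fun t _ => ?_
    congr 2
    rw [frobInner_mul_right, Matrix.conjTranspose_conjTranspose, frobInner_mul_left,
      Matrix.conjTranspose_conjTranspose, frobInner_single, re_star_unitQuat_mul]
  simp only [e]
  rw [lintegral_finsetSum _ fun t _ =>
    ((continuous_frobInner_left _).measurable.pow_const 2).ennreal_ofReal]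
  simp only [lintegral_frobInner_sq_gaussMat, frobSq_mul_single_mul, normSq_unitQuat, mul_one]
  rw [← ENNReal.ofReal_sum_of_nonneg fun t _ =>
    mul_nonneg (Finset.sum_nonneg fun _ _ => Quaternion.normSq_nonneg)
      (Finset.sum_nonneg fun _ _ => Quaternion.normSq_nonneg)]
  congr 1
  rw [Fintype.sum_prod_type]
  simp only [Finset.sum_const, Finset.card_univ, Fintype.card_fin, nsmul_eq_mul, ← Finset.mul_sum]
  rw [Fintype.sum_prod_type, frobSq_eq_sum K, frobSq_eq_sum B, mul_assoc, Finset.sum_comm (γ := Fin m)]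
  simp only [← Finset.mul_sum, ← Finset.sum_mul]
  norm_num

theorem oversampling_nonneg {s l : ℕ} (h : s ≤ l) : 0 ≤ oversampling s l := by
  have : (s : ℝ) ≤ l := by exact_mod_cast h
  unfold oversampling
  have : 0 ≤ (l : ℝ) - s := by linarith
  positivity

/-- For the orthonormal basis `H * R` the product is a Gaussian matrix, almost surely of full column
rank; an invertible change of columns returns to `H`. -/
theorem ae_isUnit_gram_mul {l m s : ℕ} (hsl : s ≤ l) {H : QMatrix m s} (hH : FullColumnRank H) :
    ∀ᵐ P ∂gaussMat l m, IsUnit ((P * H)ᴴ * (P * H)) := by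
  obtain ⟨R, R', h1, h2, h3⟩ := hH.exists_normalizer
  have hc : Continuous fun P : QMatrix l m => P * (H * R) :=
    continuous_id.matrix_mul continuous_const
  have hae := ae_isUnit_gram_gaussMat hsl
  rw [← gaussMat_map_mul h3] at hae
  filter_upwards [ae_of_ae_map hc.measurable.aemeasurable hae] with P hP
  have := (leftInv_mul_invertible hP h1 h2).1
  rwa [Matrix.mul_assoc P, Matrix.mul_assoc H, h1, Matrix.mul_one] at this

/-- The expected squared error of the least squares sketch is at most `1 + f (s, l)` times the
squared error of any approximation with columns in the range of `H`. -/
theorem lintegral_sketch_error_le {l m s n : ℕ} (hsl : s ≤ l) {H : QMatrix m s}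
    (hH : FullColumnRank H) (A : QMatrix m n) (N : QMatrix s n) :
    ∫⁻ P, ENNReal.ofReal (frobSq (H * (leftInv (P * H) * (P * A)) - A)) ∂gaussMat l m ≤
      ENNReal.ofReal (1 + oversampling s l) * ENNReal.ofReal (frobSq (A - H * N)) := by
  obtain ⟨R, R', h1, h2, h3⟩ := hH.exists_normalizer
  set Q := H * R with hQ
  have hHQ : H = Q * R' := by rw [hQ, Matrix.mul_assoc, h1, Matrix.mul_one]
  set B := A - Q * (Qᴴ * A) with hB
  have hQB : Qᴴ * B = 0 := by
    rw [hB, Matrix.mul_sub, ← Matrix.mul_assoc Qᴴ Q, h3, Matrix.one_mul, sub_self]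
  have hBN : frobSq B ≤ frobSq (A - H * N) := by
    rw [hHQ, Matrix.mul_assoc]
    exact frobSq_sub_proj_le h3 A _
  have hpair := gaussMat_map_mul_pair (l := l) h3 hQB
  have hBm : Measurable fun P : QMatrix l m => P * B :=
    (continuous_id.matrix_mul continuous_const).measurable
  have hQm : Measurable fun P : QMatrix l m => P * Q :=
    (continuous_id.matrix_mul continuous_const).measurable
  -- The sketch reproduces the component of `A` in the range of `Q` exactly. What remains lies
  -- partly in that range and partly (`-B`) orthogonal to it.
  have hpt : ∀ᵐ P ∂gaussMat l m,
      ENNReal.ofReal (frobSq (H * (leftInv (P * H) * (P * A)) - A)) =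
        ENNReal.ofReal (frobSq (leftInv (P * Q) * (P * B))) + ENNReal.ofReal (frobSq B) := by
    have hae := ae_isUnit_gram_gaussMat hsl
    rw [← gaussMat_map_mul h3] at hae
    filter_upwards [ae_of_ae_map hQm.aemeasurable hae] with P hP
    have e1 : leftInv (P * H) = R * leftInv (P * Q) := by
      have := (leftInv_mul_invertible hP h1 h2).2
      rwa [Matrix.mul_assoc, ← hHQ] at this
    have hA : A = Q * (Qᴴ * A) + B := by rw [hB, add_sub_cancel]
    have e2 : H * (leftInv (P * H) * (P * A)) - A = Q * (leftInv (P * Q) * (P * B)) + -B := by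
      have e3 : H * (leftInv (P * H) * (P * A)) = Q * (leftInv (P * Q) * (P * A)) := by
        rw [e1, hQ]
        simp only [Matrix.mul_assoc]
      have e4 : leftInv (P * Q) * (P * A) = Qᴴ * A + leftInv (P * Q) * (P * B) := by
        conv_lhs => rw [hA, Matrix.mul_add, Matrix.mul_add]
        rw [← Matrix.mul_assoc P Q, ← Matrix.mul_assoc _ (P * Q), leftInv_mul_self hP,
          Matrix.one_mul]
      rw [e3, e4, Matrix.mul_add]
      nth_rw 2 [hA]
      abel
    have horth : frobInner (Q * (leftInv (P * Q) * (P * B))) (-B) = 0 := by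
      rw [frobInner_mul_left, Matrix.mul_neg, hQB, neg_zero, frobInner_zero_right]
    rw [e2, frobSq_add_of_orthogonal horth, frobSq_neg, frobSq_isometry_mul h3,
      ENNReal.ofReal_add (frobSq_nonneg _) (frobSq_nonneg _)]
  have hm : Measurable fun p : QMatrix l s × QMatrix l n =>
      ENNReal.ofReal (frobSq (leftInv p.1 * p.2)) :=
    (continuous_frobSq.measurable.comp (measurable_qMatrix_mul
      ((measurable_leftInv l s).comp measurable_fst) measurable_snd)).ennreal_ofReal
  have hprob := Measure.isProbabilityMeasure_map (μ := gaussMat l m) hBm.aemeasurable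
  have hmain : ∫⁻ P, ENNReal.ofReal (frobSq (leftInv (P * Q) * (P * B))) ∂gaussMat l m ≤
      ENNReal.ofReal (oversampling s l) * ENNReal.ofReal (frobSq B) := by
    calc ∫⁻ P, ENNReal.ofReal (frobSq (leftInv (P * Q) * (P * B))) ∂gaussMat l m
        = ∫⁻ p, ENNReal.ofReal (frobSq (leftInv p.1 * p.2))
            ∂(gaussMat l s).prod ((gaussMat l m).map fun P : QMatrix l m => P * B) := by
          rw [← hpair, lintegral_map hm (continuous_mul_pair Q B).measurable]
      -- Independence of `P * Q` and `P * B` decouples the inverse from the residual.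
      _ = ∫⁻ M, ∫⁻ P, ENNReal.ofReal (frobSq (leftInv M * (P * B))) ∂gaussMat l m
            ∂gaussMat l s := by
          rw [lintegral_prod _ hm.aemeasurable]
          refine lintegral_congr fun M => ?_
          have hm' : Measurable fun Z : QMatrix l n =>
              ENNReal.ofReal (frobSq (leftInv M * Z)) :=
            (continuous_frobSq.measurable.comp (measurable_qMatrix_mul measurable_const
              measurable_id)).ennreal_ofReal
          rw [lintegral_map hm' hBm]
      _ = ∫⁻ M, ENNReal.ofReal (4 * frobSq B) * ENNReal.ofReal (frobSq (leftInv M))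
            ∂gaussMat l s := by
          refine lintegral_congr fun M => ?_
          rw [lintegral_frobSq_mul_mul_gaussMat,
            ← ENNReal.ofReal_mul (mul_nonneg zero_le_four (frobSq_nonneg _))]
          congr 1
          ring
      _ = ENNReal.ofReal (4 * frobSq B) *
            ∫⁻ M, ENNReal.ofReal (frobSq (leftInv M)) ∂gaussMat l s :=
          lintegral_const_mul _
            (continuous_frobSq.measurable.comp (measurable_leftInv l s)).ennreal_ofReal
      _ ≤ ENNReal.ofReal (4 * frobSq B) * ENNReal.ofReal (s / (4 * ((l : ℝ) - s) + 2)) := by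
          gcongr
          exact lintegral_leftInv_le hsl
      _ = ENNReal.ofReal (oversampling s l) * ENNReal.ofReal (frobSq B) := by
          rw [← ENNReal.ofReal_mul (mul_nonneg zero_le_four (frobSq_nonneg _)),
            ← ENNReal.ofReal_mul (oversampling_nonneg hsl), oversampling]
          congr 1
          ring
  rw [lintegral_congr_ae hpt, lintegral_add_right _ measurable_const, lintegral_const,
    measure_univ, mul_one]
  calc _ ≤ ENNReal.ofReal (oversampling s l) * ENNReal.ofReal (frobSq B) +
        ENNReal.ofReal (frobSq B) := by gcongr
    _ = ENNReal.ofReal (1 + oversampling s l) * ENNReal.ofReal (frobSq B) := by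
        rw [ENNReal.ofReal_add zero_le_one (oversampling_nonneg hsl), ENNReal.ofReal_one]
        ring
    _ ≤ _ := by gcongr

/-- The randomized range finder bound: some matrix with columns in the range of `A * O` has
expected squared distance at most `1 + f (r, s)` times the optimal one from `A`. -/
theorem lintegral_rangefinder_error_le {m n s r : ℕ} (hrs : r ≤ s) (A : QMatrix m n)
    {W : QMatrix n r} (hW : Wᴴ * W = 1) :
    ∫⁻ O, ENNReal.ofReal (frobSq (A - A * O * ((leftInv (Oᴴ * W))ᴴ * Wᴴ))) ∂gaussMat n s ≤
      ENNReal.ofReal (1 + oversampling r s) * ENNReal.ofReal (frobSq (A - A * W * Wᴴ)) := by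
  have hWr : FullColumnRank W := FullColumnRank.of_isUnit_gram (by rw [hW]; exact isUnit_one)
  -- The adjoint problem is a sketched least squares problem for `Aᴴ` in the range of `W`, with
  -- Gaussian sketch `Oᴴ`; its solution is a combination of the columns of `A * O` after taking
  -- adjoints.
  have h := lintegral_sketch_error_le hrs hWr Aᴴ (Wᴴ * Aᴴ)
  have e1 : frobSq (Aᴴ - W * (Wᴴ * Aᴴ)) = frobSq (A - A * W * Wᴴ) := by
    rw [← frobSq_conjTranspose (A - A * W * Wᴴ)]
    simp only [Matrix.conjTranspose_sub, Matrix.conjTranspose_mul,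
      Matrix.conjTranspose_conjTranspose]
  have hm : Measurable fun P : QMatrix s n =>
      ENNReal.ofReal (frobSq (W * (leftInv (P * W) * (P * Aᴴ)) - Aᴴ)) := by
    have h1 : Measurable fun P : QMatrix s n => W * (leftInv (P * W) * (P * Aᴴ)) :=
      measurable_qMatrix_mul measurable_const (measurable_qMatrix_mul
        ((measurable_leftInv s r).comp (measurable_qMatrix_mul measurable_id measurable_const))
        (measurable_qMatrix_mul measurable_id measurable_const))
    have h2 : Continuous fun M : QMatrix n m => frobSq (M - Aᴴ) :=
      continuous_frobSq.comp (continuous_id.sub continuous_const)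
    exact (h2.measurable.comp h1).ennreal_ofReal
  have hct : Measurable fun O : QMatrix n s => Oᴴ := continuous_id.matrix_conjTranspose.measurable
  rw [e1, ← gaussMat_map_conjTranspose, lintegral_map hm hct] at h
  refine (lintegral_congr fun O => ?_).trans_le h
  congr 1
  rw [frobSq_sub_comm, ← frobSq_conjTranspose]
  simp only [Matrix.conjTranspose_sub, Matrix.conjTranspose_mul,
    Matrix.conjTranspose_conjTranspose, Matrix.mul_assoc]

/-- Integrating a pointwise error estimate with square integrable coefficients. -/
theorem integral_le_errorBound_of_sq {Ω : Type*} [MeasurableSpace Ω] {μ : Measure Ω}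
    [IsProbabilityMeasure μ] {f e k : Ω → ℝ} {τ C : ℝ} (hf : AEStronglyMeasurable f μ)
    (hf0 : ∀ ω, 0 ≤ f ω) (he : MemLp e 2 μ) (he0 : ∀ ω, 0 ≤ e ω) (hk : MemLp k 2 μ)
    (hk0 : ∀ ω, 0 ≤ k ω) (hτ : 0 ≤ τ) (hle : ∀ᵐ ω ∂μ, f ω ≤ (1 + k ω) * e ω + k ω * τ)
    (hC : 0 ≤ C) (hCe : ∫ ω, e ω ^ 2 ∂μ ≤ C * τ ^ 2) :
    Integrable f μ ∧ ∫ ω, f ω ∂μ ≤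
      ((1 + √(∫ ω, k ω ^ 2 ∂μ)) * √C + √(∫ ω, k ω ^ 2 ∂μ)) * τ := by
  -- Cauchy-Schwarz, used for the product of `k` and `e` and, against the constant one, for each of
  -- them alone.
  have hCS : ∀ g h : Ω → ℝ, (∀ ω, 0 ≤ g ω) → (∀ ω, 0 ≤ h ω) → MemLp g 2 μ → MemLp h 2 μ →
      ∫ ω, g ω * h ω ∂μ ≤ √(∫ ω, g ω ^ 2 ∂μ) * √(∫ ω, h ω ^ 2 ∂μ) := by
    intro g h hg0 hh0 hg hh
    have := integral_mul_le_Lp_mul_Lq_of_nonneg (μ := μ) Real.HolderConjugate.two_two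
      (Filter.Eventually.of_forall hg0) (Filter.Eventually.of_forall hh0)
      (by simpa using hg) (by simpa using hh)
    simpa [Real.sqrt_eq_rpow] using this
  have hone : MemLp (fun _ : Ω => (1 : ℝ)) 2 μ := memLp_const 1
  have hei : Integrable e μ := he.integrable one_le_two
  have hki : Integrable k μ := hk.integrable one_le_two
  have hkei : Integrable (fun ω => k ω * e ω) μ := hk.integrable_mul he
  have hbi : Integrable (fun ω => (1 + k ω) * e ω + k ω * τ) μ := by
    simp only [add_mul, one_mul]
    exact (hei.add hkei).add (hki.mul_const τ)
  have hfi : Integrable f μ := hbi.mono' hf (by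
    filter_upwards [hle] with ω h
    rwa [Real.norm_of_nonneg (hf0 ω)])
  refine ⟨hfi, (integral_mono_ae hfi hbi hle).trans ?_⟩
  set K := √(∫ ω, k ω ^ 2 ∂μ) with hK
  have hK0 : 0 ≤ K := Real.sqrt_nonneg _
  have hE : √(∫ ω, e ω ^ 2 ∂μ) ≤ √C * τ := by
    refine (Real.sqrt_le_sqrt hCe).trans_eq ?_
    rw [Real.sqrt_mul hC, Real.sqrt_sq hτ]
  have h1 : ∫ ω, e ω ∂μ ≤ √C * τ := by
    refine le_trans ?_ hE
    simpa using hCS _ _ (fun _ => zero_le_one) he0 hone he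
  have h2 : ∫ ω, k ω ∂μ ≤ K := by
    simpa using hCS _ _ (fun _ => zero_le_one) hk0 hone hk
  have h3 : ∫ ω, k ω * e ω ∂μ ≤ K * (√C * τ) :=
    (hCS _ _ hk0 he0 hk he).trans (mul_le_mul_of_nonneg_left hE hK0)
  have h4 : ∫ ω, ((1 + k ω) * e ω + k ω * τ) ∂μ =
      ∫ ω, e ω ∂μ + ∫ ω, k ω * e ω ∂μ + (∫ ω, k ω ∂μ) * τ := by
    simp only [add_mul, one_mul]
    rw [integral_add (f := fun ω => e ω + k ω * e ω) (hei.add hkei) (hki.mul_const τ),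
      integral_add hei hkei, integral_mul_const]
  rw [h4]
  have h5 := mul_le_mul_of_nonneg_right h2 hτ
  linarith

end SketchError

/-! ### Conditioning on the first test matrix, and the final assembly. -/

section MainResult

theorem continuous_frobNorm {m n : ℕ} : Continuous fun A : QMatrix m n => frobNorm A := by
  simp only [frobNorm_eq_sqrt]
  exact continuous_frobSq.sqrt

/-- Lets the near-optimal approximation built from the columns of `A * Om` serve as a competitor in
the range of `H`. -/
theorem exists_mul_eq_of_range_eq {m n s k : ℕ} {H : QMatrix m s} {Y : QMatrix m n}
    (h : range H = range Y) (M : QMatrix n k) : ∃ N : QMatrix s k, H * N = Y * M := by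
  have hx : ∀ j : Fin k, ∃ x : Fin s → ℍ[ℝ], Y *ᵥ (fun i => M i j) = H *ᵥ x := by
    intro j
    have : Y *ᵥ (fun i => M i j) ∈ range Y := ⟨_, rfl⟩
    rwa [← h] at this
  choose x hx using hx
  refine ⟨Matrix.of fun i j => x j i, ?_⟩
  ext1 i j
  exact (congrFun (hx j) i).symm

variable {Ω : Type*} [MeasurableSpace Ω] {μ : Measure Ω} [IsProbabilityMeasure μ]
  {m n r s l : ℕ} {Om : Ω → QMatrix n s} {Psi : Ω → QMatrix l m}

theorem map_pair_eq_prod_gaussMat (hOm : IsStdGaussian μ Om) (hPsi : IsStdGaussian μ Psi)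
    (hindep : IndepFun Om Psi μ) :
    μ.map (fun ω => (Om ω, Psi ω)) = (gaussMat n s).prod (gaussMat l m) := by
  rw [(indepFun_iff_map_prod_eq_prod_map_map hOm.measurable.aemeasurable
    hPsi.measurable.aemeasurable).1 hindep, hOm.map_eq, hPsi.map_eq]

/-- By independence, `H` may be held fixed while `Psi` is drawn. Hence the Moore-Penrose inverse of
`Psi * H` is almost surely given by `leftInv`, which is measurable. -/
theorem ae_isUnit_gram_sketch (hsl : s ≤ l) (hOm : IsStdGaussian μ Om)
    (hPsi : IsStdGaussian μ Psi) (hindep : IndepFun Om Psi μ) (A : QMatrix m n)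
    {F : QMatrix m s → QMatrix m s} (hF : Measurable F)
    (hrank : ∀ᵐ ω ∂μ, FullColumnRank (F (A * Om ω))) :
    ∀ᵐ ω ∂μ, IsUnit ((Psi ω * F (A * Om ω))ᴴ * (Psi ω * F (A * Om ω))) := by
  have hFA : Measurable fun O : QMatrix n s => F (A * O) :=
    hF.comp (measurable_qMatrix_mul measurable_const measurable_id)
  have hpairm : Measurable fun ω => (Om ω, Psi ω) := hOm.measurable.prodMk hPsi.measurable
  have hprod : Measurable fun p : QMatrix n s × QMatrix l m => p.2 * F (A * p.1) :=
    measurable_qMatrix_mul measurable_snd (hFA.comp measurable_fst)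
  have hms : MeasurableSet {p : QMatrix n s × QMatrix l m |
      IsUnit ((p.2 * F (A * p.1))ᴴ * (p.2 * F (A * p.1)))} :=
    hprod (measurableSet_isUnit_gram l s)
  have h1 : ∀ᵐ O ∂gaussMat n s, IsUnit ((F (A * O))ᴴ * F (A * O)) := by
    rw [← hOm.map_eq]
    refine (ae_map_iff (p := fun O => IsUnit ((F (A * O))ᴴ * F (A * O)))
      hOm.measurable.aemeasurable (hFA (measurableSet_isUnit_gram m s))).2 ?_
    filter_upwards [hrank] with ω hω using hω.isUnit_gram
  have h2 : ∀ᵐ p ∂μ.map (fun ω => (Om ω, Psi ω)),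
      IsUnit ((p.2 * F (A * p.1))ᴴ * (p.2 * F (A * p.1))) := by
    rw [map_pair_eq_prod_gaussMat hOm hPsi hindep, Measure.ae_prod_iff_ae_ae hms]
    filter_upwards [h1] with O hO
    exact ae_isUnit_gram_mul hsl (FullColumnRank.of_isUnit_gram hO)
  exact ae_of_ae_map hpairm.aemeasurable h2

theorem measurable_sketch_error (A : QMatrix m n) {F : QMatrix m s → QMatrix m s}
    (hF : Measurable F) : Measurable fun p : QMatrix n s × QMatrix l m =>
      frobNorm (F (A * p.1) * (leftInv (p.2 * F (A * p.1)) * (p.2 * A)) - A) := by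
  have hFA : Measurable fun p : QMatrix n s × QMatrix l m => F (A * p.1) :=
    hF.comp (measurable_qMatrix_mul measurable_const measurable_fst)
  have h1 : Measurable fun p : QMatrix n s × QMatrix l m =>
      F (A * p.1) * (leftInv (p.2 * F (A * p.1)) * (p.2 * A)) :=
    measurable_qMatrix_mul hFA (measurable_qMatrix_mul
      ((measurable_leftInv l s).comp (measurable_qMatrix_mul measurable_snd hFA))
      (measurable_qMatrix_mul measurable_snd measurable_const))
  have h2 : Continuous fun M : QMatrix m n => frobNorm (M - A) :=
    continuous_frobNorm.comp (continuous_id.sub continuous_const)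
  exact h2.measurable.comp h1

/-- The second moment of the error of the untruncated approximation. -/
theorem lintegral_sketch_error_sq_le (hrs : r ≤ s) (hsl : s ≤ l) (hOm : IsStdGaussian μ Om)
    (hPsi : IsStdGaussian μ Psi) (hindep : IndepFun Om Psi μ) (A : QMatrix m n)
    {F : QMatrix m s → QMatrix m s} (hF : Measurable F) {W : QMatrix n r} (hW : Wᴴ * W = 1)
    (hrange : ∀ᵐ ω ∂μ, range (F (A * Om ω)) = range (A * Om ω) ∧
      FullColumnRank (F (A * Om ω))) :
    ∫⁻ ω, ENNReal.ofReal (frobNorm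
        (F (A * Om ω) * (leftInv (Psi ω * F (A * Om ω)) * (Psi ω * A)) - A) ^ 2) ∂μ ≤
      ENNReal.ofReal ((1 + oversampling s l) * (1 + oversampling r s) *
        frobSq (A - A * W * Wᴴ)) := by
  have hpairm : Measurable fun ω => (Om ω, Psi ω) := hOm.measurable.prodMk hPsi.measurable
  have hm : Measurable fun p : QMatrix n s × QMatrix l m => ENNReal.ofReal
      (frobNorm (F (A * p.1) * (leftInv (p.2 * F (A * p.1)) * (p.2 * A)) - A) ^ 2) :=
    ((measurable_sketch_error A hF).pow_const 2).ennreal_ofReal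
  have hm2 : Measurable fun O : QMatrix n s =>
      ENNReal.ofReal (frobSq (A - A * O * ((leftInv (Oᴴ * W))ᴴ * Wᴴ))) := by
    have hct : ∀ {a b : ℕ}, Measurable fun O : QMatrix a b => Oᴴ := fun {_ _} =>
      continuous_id.matrix_conjTranspose.measurable
    have h1 : Measurable fun O : QMatrix n s => A * O * ((leftInv (Oᴴ * W))ᴴ * Wᴴ) :=
      measurable_qMatrix_mul (measurable_qMatrix_mul measurable_const measurable_id)
        (measurable_qMatrix_mul (hct.comp ((measurable_leftInv s r).comp
          (measurable_qMatrix_mul hct measurable_const))) measurable_const)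
    have h2 : Continuous fun M : QMatrix m n => frobSq (A - M) :=
      continuous_frobSq.comp (continuous_const.sub continuous_id)
    exact (h2.measurable.comp h1).ennreal_ofReal
  have hs0 : 0 ≤ 1 + oversampling s l := add_nonneg zero_le_one (oversampling_nonneg hsl)
  have hr0 : 0 ≤ 1 + oversampling r s := add_nonneg zero_le_one (oversampling_nonneg hrs)
  calc ∫⁻ ω, ENNReal.ofReal (frobNorm
        (F (A * Om ω) * (leftInv (Psi ω * F (A * Om ω)) * (Psi ω * A)) - A) ^ 2) ∂μ
      = ∫⁻ p, ENNReal.ofReal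
          (frobNorm (F (A * p.1) * (leftInv (p.2 * F (A * p.1)) * (p.2 * A)) - A) ^ 2)
          ∂(gaussMat n s).prod (gaussMat l m) := by
        rw [← map_pair_eq_prod_gaussMat hOm hPsi hindep, lintegral_map hm hpairm]
    _ = ∫⁻ ω, ∫⁻ P, ENNReal.ofReal (frobNorm
          (F (A * Om ω) * (leftInv (P * F (A * Om ω)) * (P * A)) - A) ^ 2) ∂gaussMat l m ∂μ := by
        rw [lintegral_prod _ hm.aemeasurable, ← hOm.map_eq,
          lintegral_map hm.lintegral_prod_right' hOm.measurable]
    _ ≤ ∫⁻ ω, ENNReal.ofReal (1 + oversampling s l) * ENNReal.ofReal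
          (frobSq (A - A * Om ω * ((leftInv ((Om ω)ᴴ * W))ᴴ * Wᴴ))) ∂μ := by
        refine lintegral_mono_ae ?_
        filter_upwards [hrange] with ω hω
        -- Equality of ranges replaces the distance from `A` to the range of `H` by the explicit
        -- range finder error, a function of `Om` alone.
        obtain ⟨N, hN⟩ := exists_mul_eq_of_range_eq hω.1 ((leftInv ((Om ω)ᴴ * W))ᴴ * Wᴴ)
        simp only [sq_frobNorm]
        rw [← hN]
        exact lintegral_sketch_error_le hsl hω.2 A N
    _ = ENNReal.ofReal (1 + oversampling s l) * ∫⁻ O, ENNReal.ofReal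
          (frobSq (A - A * O * ((leftInv (Oᴴ * W))ᴴ * Wᴴ))) ∂gaussMat n s := by
        rw [← hOm.map_eq, lintegral_map hm2 hOm.measurable, lintegral_const_mul']
        exact ENNReal.ofReal_ne_top
    _ ≤ ENNReal.ofReal (1 + oversampling s l) * (ENNReal.ofReal (1 + oversampling r s) *
          ENNReal.ofReal (frobSq (A - A * W * Wᴴ))) := by
        gcongr
        exact lintegral_rangefinder_error_le hrs A hW
    _ = _ := by
        rw [← ENNReal.ofReal_mul hr0, ← ENNReal.ofReal_mul hs0, mul_assoc]

omit [IsProbabilityMeasure μ] in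
theorem memLp_two_of_lintegral_sq_le {e : Ω → ℝ} {C : ℝ} (hm : Measurable e) (hC : 0 ≤ C)
    (hle : ∫⁻ ω, ENNReal.ofReal (e ω ^ 2) ∂μ ≤ ENNReal.ofReal C) :
    MemLp e 2 μ ∧ ∫ ω, e ω ^ 2 ∂μ ≤ C := by
  have hnn := Filter.Eventually.of_forall (f := ae μ) fun ω => sq_nonneg (e ω)
  have hint : Integrable (fun ω => e ω ^ 2) μ :=
    (lintegral_ofReal_ne_top_iff_integrable (hm.pow_const 2).aestronglyMeasurable hnn).1
      (hle.trans_lt ENNReal.ofReal_lt_top).ne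
  refine ⟨(memLp_two_iff_integrable_sq hm.aestronglyMeasurable).2 hint, ?_⟩
  rw [← ofReal_integral_eq_lintegral_ofReal hint hnn] at hle
  exact (ENNReal.ofReal_le_ofReal_iff hC).1 hle

theorem memLp_sketch_error (hrs : r ≤ s) (hsl : s ≤ l) (hOm : IsStdGaussian μ Om)
    (hPsi : IsStdGaussian μ Psi) (hindep : IndepFun Om Psi μ) (A : QMatrix m n)
    {F : QMatrix m s → QMatrix m s} (hF : Measurable F) {W : QMatrix n r} (hW : Wᴴ * W = 1)
    (hrange : ∀ᵐ ω ∂μ, range (F (A * Om ω)) = range (A * Om ω) ∧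
      FullColumnRank (F (A * Om ω))) :
    MemLp (fun ω => frobNorm
        (F (A * Om ω) * (leftInv (Psi ω * F (A * Om ω)) * (Psi ω * A)) - A)) 2 μ ∧
      ∫ ω, frobNorm
        (F (A * Om ω) * (leftInv (Psi ω * F (A * Om ω)) * (Psi ω * A)) - A) ^ 2 ∂μ ≤
      (1 + oversampling s l) * (1 + oversampling r s) * frobSq (A - A * W * Wᴴ) := by
  have hle := lintegral_sketch_error_sq_le hrs hsl hOm hPsi hindep A hF hW hrange
  have hm := measurable_sketch_error (l := l) A hF
  have hpairm := hOm.measurable.prodMk hPsi.measurable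
  have hmc := hm.comp hpairm
  exact memLp_two_of_lintegral_sq_le hmc (mul_nonneg (mul_nonneg
    (add_nonneg zero_le_one (oversampling_nonneg hsl))
    (add_nonneg zero_le_one (oversampling_nonneg hrs))) (frobSq_nonneg _)) hle

end MainResult

end QMat

theorem mainTheorem4 {Ω : Type*} [MeasurableSpace Ω] (μ : Measure Ω) [IsProbabilityMeasure μ]
    (m n r s l : ℕ) (hnm : n ≤ m) (hrs : r ≤ s) (hsl : s ≤ l) (hl : l ≤ min m n)
    -- the data matrix, with its QSVD
    (A : QMat.QMatrix m n) (U : QMat.QMatrix m m) (σ : ℕ → ℝ) (V : QMat.QMatrix n n)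
    (hA : QMat.IsQSVD A U σ V)
    -- independent standard Gaussian test matrices
    (Om : Ω → QMat.QMatrix n s) (Psi : Ω → QMat.QMatrix l m)
    (hOm : QMat.IsStdGaussian μ Om) (hPsi : QMat.IsStdGaussian μ Psi)
    (hindep : IndepFun Om Psi μ)
    -- the rangefinder map
    (F : QMat.QMatrix m s → QMat.QMatrix m s) (hF : Measurable F)
    -- the sketches and the output of the QB stage
    (Y : Ω → QMat.QMatrix m s) (hY : ∀ ω, Y ω = A * Om ω)
    (W : Ω → QMat.QMatrix l n) (hW : ∀ ω, W ω = Psi ω * A)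
    (H : Ω → QMat.QMatrix m s) (hH : ∀ ω, H ω = F (Y ω))
    (X : Ω → QMat.QMatrix s n) (hX : ∀ ω, X ω = QMat.pinv (Psi ω * H ω) * W ω)
    -- the rangefinder is range-preserving and of full column rank
    (hrange : ∀ᵐ ω ∂μ, QMat.range (H ω) = QMat.range (Y ω) ∧ QMat.FullColumnRank (H ω))
    -- the truncation stage
    (T : Ω → QMat.QMatrix s n) (hTm : AEMeasurable T μ)
    (hT : ∀ᵐ ω ∂μ, QMat.IsTruncatedQSVD r (X ω) (T ω))
    (Ahat : Ω → QMat.QMatrix m n) (hAhat : ∀ ω, Ahat ω = H ω * T ω) :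
    (∀ κ : ℝ, (∀ᵐ ω ∂μ, QMat.condNum (H ω) ≤ κ) →
      Integrable (fun ω => QMat.frobNorm (Ahat ω - A)) μ ∧
      ∫ ω, QMat.frobNorm (Ahat ω - A) ∂μ ≤ QMat.errorBound r s l κ (QMat.tailNorm r n σ)) ∧
    (MemLp (fun ω => QMat.condNum (H ω)) 2 μ →
      Integrable (fun ω => QMat.frobNorm (Ahat ω - A)) μ ∧
      ∫ ω, QMat.frobNorm (Ahat ω - A) ∂μ ≤
        QMat.errorBound r s l (Real.sqrt (∫ ω, QMat.condNum (H ω) ^ 2 ∂μ))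
          (QMat.tailNorm r n σ)) := by
  have hsn : s ≤ n := (hsl.trans hl).trans (min_le_right _ _)
  have hrn : r ≤ n := hrs.trans hsn
  set Wr := QMat.leadingCols r V with hWr
  have hWiso : Wrᴴ * Wr = 1 := QMat.leadingCols_isometry hrn hA.right_unitary.1
  have hτ0 : 0 ≤ QMat.tailNorm r n σ := Real.sqrt_nonneg _
  have htail : QMat.frobSq (A - A * Wr * Wrᴴ) = QMat.tailNorm r n σ ^ 2 :=
    hA.frobSq_sub_leadingCols hnm hrn
  have hHm : Measurable H := by
    rw [show H = fun ω => F (A * Om ω) from funext fun ω => by rw [hH, hY]]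
    exact hF.comp (QMat.measurable_qMatrix_mul measurable_const hOm.measurable)
  -- The untruncated error, written with `leftInv`; it agrees with the error of `X` almost surely.
  set e : Ω → ℝ := fun ω => QMat.frobNorm
    (H ω * (QMat.leftInv (Psi ω * H ω) * (Psi ω * A)) - A) with he
  have he0 : ∀ ω, 0 ≤ e ω := fun ω => QMat.frobNorm_nonneg _
  have hXe : ∀ᵐ ω ∂μ, X ω = QMat.leftInv (Psi ω * H ω) * (Psi ω * A) := by
    filter_upwards [QMat.ae_isUnit_gram_sketch hsl hOm hPsi hindep A hF
      (by filter_upwards [hrange] with ω hω; rw [← hY, ← hH]; exact hω.2)] with ω hω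
    rw [hX, hW, QMat.pinv_eq_leftInv]
    rwa [hH, hY]
  obtain ⟨hemem, hesq⟩ := QMat.memLp_sketch_error hrs hsl hOm hPsi hindep A hF hWiso
    (by
      filter_upwards [hrange] with ω hω
      rw [← hY, ← hH]
      exact hω)
  rw [htail] at hesq
  simp only [← hY, ← hH] at hemem hesq
  have hdet : ∀ᵐ ω ∂μ, QMat.frobNorm (Ahat ω - A) ≤
      (1 + QMat.condNum (H ω)) * e ω + QMat.condNum (H ω) * QMat.tailNorm r n σ := by
    filter_upwards [hrange, hT, hXe] with ω h1 h2 h3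
    have := QMat.frobNorm_mul_truncated_sub_le hrs hsn h1.2 A hWiso h2
    rwa [QMat.frobNorm_eq_sqrt (A - A * Wr * Wrᴴ), htail, Real.sqrt_sq hτ0, ← hAhat, h3] at this
  have hfm : AEStronglyMeasurable (fun ω => QMat.frobNorm (Ahat ω - A)) μ := by
    have h1 : Measurable fun ω => H ω * hTm.mk T ω :=
      QMat.measurable_qMatrix_mul hHm hTm.measurable_mk
    have h2 : Measurable fun M : QMat.QMatrix m n => QMat.frobNorm (M - A) :=
      (QMat.continuous_frobNorm.comp (continuous_id.sub continuous_const)).measurable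
    -- `T` is only almost everywhere measurable, so a measurable version replaces it.
    refine AEStronglyMeasurable.congr (h2.comp h1).aestronglyMeasurable ?_
    filter_upwards [hTm.ae_eq_mk] with ω hω
    rw [Function.comp_apply, ← hω, ← hAhat]
  have hf0 : ∀ ω, 0 ≤ QMat.frobNorm (Ahat ω - A) := fun ω => QMat.frobNorm_nonneg _
  have hC : 0 ≤ (1 + QMat.oversampling s l) * (1 + QMat.oversampling r s) :=
    mul_nonneg (add_nonneg zero_le_one (QMat.oversampling_nonneg hsl))
      (add_nonneg zero_le_one (QMat.oversampling_nonneg hrs))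
  refine ⟨fun κ hκ => ?_, fun hκ => ?_⟩
  · have hκ0 : 0 ≤ κ := by
      -- On a probability space an almost sure bound holds at some point, where the condition number
      -- is nonnegative.
      obtain ⟨ω, hω⟩ := hκ.exists
      exact (QMat.condNum_nonneg _).trans hω
    have hle : ∀ᵐ ω ∂μ, QMat.frobNorm (Ahat ω - A) ≤
        (1 + κ) * e ω + κ * QMat.tailNorm r n σ := by
      filter_upwards [hdet, hκ] with ω h1 h2
      have h3 := mul_le_mul_of_nonneg_right h2 (he0 ω)
      have h4 := mul_le_mul_of_nonneg_right h2 hτ0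
      linarith
    -- The constant coefficient `κ`, whose root mean square is `κ` itself; measurability of the
    -- condition number is not involved.
    have := QMat.integral_le_errorBound_of_sq hfm hf0 hemem he0 (memLp_const κ)
      (fun _ => hκ0) hτ0 hle hC hesq
    simpa [QMat.errorBound, Real.sqrt_sq hκ0] using this
  · exact QMat.integral_le_errorBound_of_sq hfm hf0 hemem he0 hκ
      (fun _ => QMat.condNum_nonneg _) hτ0 hdet hC hesq
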